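/- Let $k,m,n$ be positive integers with $1\le k<\min\{m,n\}$, let $\mathcal H_m=\mathbb C^m$ and $\mathcal H_n=\mathbb C^n$, and let $\mathcal L(\mathcal H)$ be the space of linear operators on $\mathcal H$; identify $\mathcal L(\mathcal H_m)\otimes\mathcal L(\mathcal H_n)$ with $\mathcal L(\mathcal H_m\otimes\mathcal H_n)$. For a unit vector $|v\rangle=\sum_{i,j}v_{ij}\,|i\rangle\otimes|j\rangle\in\mathcal H_m\otimes\mathcal H_n$ (with $|1\rangle,|2\rangle,\dots$ the standard basis vectors), its Schmidt rank $SR(|v\rangle)$ is the rank of the $m\times n$ matrix $(v_{ij})$, i.e. the number of non-zero terms in the Schmidt decomposition of $|v\rangle$. Let $$\mathcal S:=\big\{c\,|v\rangle\langle w| \;:\; c\in\mathbb R,\ |v\rangle,|w\rangle\in\mathcal H_m\otimes\mathcal H_n \text{ unit vectors with } SR(|v\rangle),SR(|w\rangle)\le k\big\}.$$ Let $\Phi:\mathcal L(\mathcal H_m)\otimes\mathcal L(\mathcal H_n)\to\mathcal L(\mathcal H_m)\otimes\mathcal L(\mathcal H_n)$ be an invertible linear map. Then $\Phi(\mathcal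 S)\subseteq\mathcal S$ if and only if $\Phi$ can be written as a composition of one or more of the following maps: (a) $X\mapsto LXM$, where each of $L,M\in\mathcal L(\mathcal H_m)\otimes\mathcal L(\mathcal H_n)$ is either of the form $P\otimes Q$ or, if $n=m$, of the form $S(P\otimes Q)$, with $P\in\mathcal L(\mathcal H_m)$ and $Q\in\mathcal L(\mathcal H_n)$ nonsingular and $S$ the swap operator, $S(|a\rangle\otimes|b\rangle)=|b\rangle\otimes|a\rangle$; (b) the transpose map $X\mapsto X^T$ (in the standard basis $|i\rangle\otimes|j\rangle$); (c) if $k=1$, the partial transpose map $id_m\otimes T$, determined by $A\otimes B\mapsto A\otimes B^T$. -/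

import Mathlib

open scoped Kronecker

/-- Vectors of `H_m ⊗ H_n`, where `H_m = ℂ^m` and `H_n = ℂ^n`, with the Euclidean norm: the
coordinate at `(i, j)` is the coefficient of `|i⟩ ⊗ |j⟩`. -/
abbrev BipartiteVec (m n : ℕ) : Type := EuclideanSpace ℂ (Fin m × Fin n)

/-- `L(H_m) ⊗ L(H_n) = L(H_m ⊗ H_n)`, in the standard basis `|i⟩ ⊗ |j⟩`. The elementary tensor
of `P` and `Q` is the Kronecker product `P ⊗ₖ Q`. -/
abbrev BipartiteOp (m n : ℕ) : Type := Matrix (Fin m × Fin n) (Fin m × Fin n) ℂ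

/-- The vector-operator isomorphism, `|a⟩ ⊗ |b⟩ ↦ |a⟩⟨b̄|` extended linearly: it sends `v` to the
`m × n` matrix `A_v` of its coordinates. -/
def vecOperator {m n : ℕ} (v : BipartiteVec m n) : Matrix (Fin m) (Fin n) ℂ :=
  Matrix.of fun i j => v (i, j)

/-- The Schmidt rank of `v`: the rank of the operator `A_v` associated with `v`, that is, the
number of non-zero singular values of `A_v` (the Schmidt coefficients of `v`). -/
noncomputable def schmidtRank {m n : ℕ} (v : BipartiteVec m n) : ℕ :=
  (vecOperator v).rank

/-- The operator `|v⟩⟨w|`. -/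
def ketBra {m n : ℕ} (v w : BipartiteVec m n) : BipartiteOp m n :=
  Matrix.of fun p q => v p * star (w q)

/-- The set of all `c |v⟩⟨w|` with `c` real and `v`, `w` unit vectors of Schmidt rank at
most `k`. -/
def rankOneSchmidt (k m n : ℕ) : Set (BipartiteOp m n) :=
  {X | ∃ (c : ℝ) (v w : BipartiteVec m n), ‖v‖ = 1 ∧ ‖w‖ = 1 ∧
    schmidtRank v ≤ k ∧ schmidtRank w ≤ k ∧ X = (c : ℂ) • ketBra v w}

/-- The swap operator `|a⟩ ⊗ |b⟩ ↦ |b⟩ ⊗ |a⟩`. It is only used for `n = m`; indices are compared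
through their values in order to avoid casts between `Fin m` and `Fin n`. -/
def swapOperator (m n : ℕ) : BipartiteOp m n :=
  Matrix.of fun p q => if (p.1 : ℕ) = q.2 ∧ (p.2 : ℕ) = q.1 then 1 else 0

theorem swapOperator_mulVec {n : ℕ} (a b : Fin n → ℂ) :
    (swapOperator n n).mulVec (fun p => a p.1 * b p.2) = fun p => b p.1 * a p.2 := by
  ext ⟨i, j⟩
  rw [Matrix.mulVec, dotProduct, Finset.sum_eq_single (j, i)]
  · simp [swapOperator, mul_comm]
  · rintro ⟨i', j'⟩ - h
    have h' : ¬ ((i : ℕ) = j' ∧ (j : ℕ) = i') := by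
      rintro ⟨h1, h2⟩
      exact h (Prod.ext (Fin.ext h2.symm) (Fin.ext h1.symm))
    simp [swapOperator, h']
  · simp

/-- `L = P ⊗ Q`, or `n = m` and `L = S (P ⊗ Q)`, with `P` and `Q` nonsingular and `S` the swap
operator. -/
def IsLocalOrSwap {m n : ℕ} (L : BipartiteOp m n) : Prop :=
  ∃ (P : Matrix (Fin m) (Fin m) ℂ) (Q : Matrix (Fin n) (Fin n) ℂ), IsUnit P ∧ IsUnit Q ∧
    (L = P ⊗ₖ Q ∨ (n = m ∧ L = swapOperator m n * (P ⊗ₖ Q)))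

/-- The partial transpose `id_m ⊗ T`: transposition of the second tensor factor. -/
def partialTranspose {m n : ℕ} (X : BipartiteOp m n) : BipartiteOp m n :=
  Matrix.of fun p q => X (p.1, q.2) (q.1, p.2)

theorem partialTranspose_kronecker {m n : ℕ} (A : Matrix (Fin m) (Fin m) ℂ)
    (B : Matrix (Fin n) (Fin n) ℂ) :
    partialTranspose (A ⊗ₖ B) = A ⊗ₖ B.transpose := by
  ext p q
  simp [partialTranspose, Matrix.kroneckerMap_apply]

/-- The three kinds of building blocks: `X ↦ L X M` with `L` and `M` invertible operators of local
or swap form; the transpose; and, if `k = 1`, the partial transpose. -/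
def IsBasicPreserver (k : ℕ) {m n : ℕ} (Ψ : Module.End ℂ (BipartiteOp m n)) : Prop :=
  (∃ L M : BipartiteOp m n, IsLocalOrSwap L ∧ IsLocalOrSwap M ∧ ∀ X, Ψ X = L * X * M) ∨
  (∀ X, Ψ X = X.transpose) ∨
  (k = 1 ∧ ∀ X, Ψ X = partialTranspose X)

/-! Absorbing scalars and conjugation, the operators in question are `x yᵀ` with the coordinate
matrices of `x` and `y` of rank at most `k`, a form that each building block visibly keeps. The
converse rests on one fact, `exists_perm_of_isPure`: a bijective linear map sending elementary
tensors to elementary tensors permutes the factors and acts by an injective linear map in each.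
Behind it is `parallel_of_isPure_add`: a sum of two nonzero elementary tensors is elementary only if
they agree, up to scalars, in all factors but one. Hence varying one factor of the argument varies a
single factor of the image, and which one cannot depend on the remaining factors.

For `k = 1` the operators are the elementary tensors in four factors, of dimensions `m, n, n, m`. If
`m = n`, every permutation is allowed, and the three adjacent swaps generating them are the swap
operator on either side and the partial transpose. If `m ≠ n`, dimensions leave four permutations,
obtained from the transpose and the partial transpose.

For `k ≥ 2` a sum of two product vectors still has Schmidt rank at most `k`, so with one side fixed
the images form a linear family of operators of rank at most one; thus `Φ` sends every `x yᵀ` to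
some `c dᵀ` (`vecMulVec_preserver`). The two-factor case gives `Φ (x yᵀ) = (A x)(B y)ᵀ` or `(B y)(A
x)ᵀ`, where `A` and `B` preserve Schmidt rank at most `k`. They then preserve product vectors,
because below both dimensions rank less than `k` is recognised linearly among matrices of rank at
most `k` (`rank_lt_of_span_eq_top`). The two-factor case, applied to `A` and `B`, makes them local
up to a swap. -/

/-! ### Elementary tensors and linear families of them -/

section PureTensor

variable {ι : Type*} {X : ι → Type*}

/-- Two vectors are parallel if all their `2 × 2` minors vanish. -/
def Parallel {Y : Type*} (a b : Y → ℂ) : Prop := ∀ x y, a x * b y = b x * a y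

theorem Parallel.refl {Y : Type*} (a : Y → ℂ) : Parallel a a := fun _ _ => rfl

theorem Parallel.symm {Y : Type*} {a b : Y → ℂ} (h : Parallel a b) : Parallel b a :=
  fun x y => (h x y).symm

theorem Parallel.trans {Y : Type*} {a b c : Y → ℂ} (hb : b ≠ 0) (h : Parallel a b)
    (h' : Parallel b c) : Parallel a c := by
  obtain ⟨z, hz⟩ := Function.ne_iff.mp hb
  simp only [Pi.zero_apply] at hz
  intro x y
  have h1 := h x z
  have h2 := h y z
  have h3 := h' z x
  have h4 := h' z y
  apply mul_left_cancel₀ (mul_ne_zero hz hz)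
  linear_combination (b z * c y) * h1 + (- b z * c x) * h2 + (b x * a z) * h4 - (b y * a z) * h3

theorem Parallel.exists_smul {Y : Type*} {a b : Y → ℂ} (hb : b ≠ 0) (h : Parallel a b) :
    ∃ c : ℂ, a = c • b := by
  obtain ⟨z, hz⟩ := Function.ne_iff.mp hb
  simp only [Pi.zero_apply] at hz
  refine ⟨a z / b z, ?_⟩
  ext x
  have := h x z
  simp only [Pi.smul_apply, smul_eq_mul]
  field_simp
  linear_combination this

theorem parallel_smul {Y : Type*} (c : ℂ) (b : Y → ℂ) : Parallel (c • b) b := by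
  intro x y
  simp only [Pi.smul_apply, smul_eq_mul]
  ring

/-- The vectors mapped by `α` to multiples of `c`. -/
def parallelPreimage {V Y : Type*} [AddCommGroup V] [Module ℂ V] (α : V →ₗ[ℂ] (Y → ℂ))
    (c : Y → ℂ) : Submodule ℂ V where
  carrier := {a | Parallel (α a) c}
  zero_mem' := by intro x y; simp
  add_mem' := by
    intro a b ha hb x y
    have h1 := ha x y
    have h2 := hb x y
    simp only [map_add, Pi.add_apply]
    linear_combination h1 + h2
  smul_mem' := by
    intro r a ha x y
    have h1 := ha x y
    simp only [map_smul, Pi.smul_apply, smul_eq_mul]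
    linear_combination r * h1

theorem not_parallel_single {Z : Type*} [DecidableEq Z] {z z' : Z} (h : z ≠ z') :
    ¬ Parallel (Pi.single z (1 : ℂ)) (Pi.single z' 1) := by
  intro hp
  have := hp z z'
  simp [h] at this

theorem parallel_of_parallel_map {Y Z : Type*} {α : (Z → ℂ) →ₗ[ℂ] (Y → ℂ)}
    (hα : Function.Injective α) {a b : Z → ℂ} (h : Parallel (α a) (α b)) : Parallel a b := by
  by_cases hb : b = 0
  · subst hb
    intro x y
    simp
  have hb' : α b ≠ 0 := fun h0 => hb (hα (by simpa using h0))
  obtain ⟨c, hc⟩ := h.exists_smul hb'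
  rw [← map_smul] at hc
  rw [hα hc]
  exact parallel_smul c b

theorem parallelPreimage_ne_top {Y Z : Type*} [DecidableEq Z] [Nontrivial Z]
    {α : (Z → ℂ) →ₗ[ℂ] (Y → ℂ)} (hα : Function.Injective α) {c : Y → ℂ} (hc : c ≠ 0) :
    parallelPreimage α c ≠ ⊤ := by
  intro htop
  obtain ⟨z, z', hz⟩ := exists_pair_ne Z
  have h1 : Parallel (α (Pi.single z 1)) c := by
    have : Pi.single z 1 ∈ parallelPreimage α c := htop ▸ Submodule.mem_top
    exact this
  have h2 : Parallel (α (Pi.single z' 1)) c := by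
    have : Pi.single z' 1 ∈ parallelPreimage α c := htop ▸ Submodule.mem_top
    exact this
  exact not_parallel_single hz (parallel_of_parallel_map hα (h1.trans hc h2.symm))

/-- With `x` outside `p` and `y` outside `q`, one of `x`, `y`, `x + y` avoids both. This supplies
the generic vector in `MovesFactor.eq_of_update`. -/
theorem exists_notMem_of_ne_top {V : Type*} [AddCommGroup V] [Module ℂ V] {p q : Submodule ℂ V}
    (hp : p ≠ ⊤) (hq : q ≠ ⊤) : ∃ a, a ∉ p ∧ a ∉ q := by
  obtain ⟨x, hx⟩ : ∃ x, x ∉ p := by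
    by_contra! h
    exact hp (Submodule.eq_top_iff'.2 h)
  obtain ⟨y, hy⟩ : ∃ y, y ∉ q := by
    by_contra! h
    exact hq (Submodule.eq_top_iff'.2 h)
  by_cases hxq : x ∈ q
  · by_cases hyp : y ∈ p
    · exact ⟨x + y, fun h => hx ((Submodule.add_mem_iff_left p hyp).1 h),
        fun h => hy ((Submodule.add_mem_iff_right q hxq).1 h)⟩
    · exact ⟨y, hyp, hy⟩
  · exact ⟨x, hx, hxq⟩

/-- If the products over a set of factors are parallel then so is each factor. -/
theorem parallel_of_prod_parallel [DecidableEq ι] {s : Finset ι} {v w : ∀ i, X i → ℂ} (hv : ∀ i, v i ≠ 0)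
    (hw : ∀ i, w i ≠ 0)
    (h : ∀ x y : ∀ i, X i, (∏ j ∈ s, v j (x j)) * ∏ j ∈ s, w j (y j) =
      (∏ j ∈ s, w j (x j)) * ∏ j ∈ s, v j (y j)) {j : ι} (hj : j ∈ s) :
    Parallel (v j) (w j) := by
  have h1 : ∀ i, ∃ x, v i x ≠ 0 := fun i => Function.ne_iff.mp (hv i)
  have h2 : ∀ i, ∃ x, w i x ≠ 0 := fun i => Function.ne_iff.mp (hw i)
  choose x hx using h1
  choose y hy using h2
  have hvx : ∏ j ∈ s, v j (x j) ≠ 0 := Finset.prod_ne_zero_iff.2 fun i _ => hx i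
  have hwy : ∏ j ∈ s, w j (y j) ≠ 0 := Finset.prod_ne_zero_iff.2 fun i _ => hy i
  -- The point `x` was chosen for `v` only; the proportionality forces the `w`-product to be nonzero
  -- there too. Varying only coordinate `j` of `x` then isolates the factor `j`.
  have hwx : ∏ j ∈ s, w j (x j) ≠ 0 := by
    intro h0
    have := h x y
    rw [h0, zero_mul] at this
    exact mul_ne_zero hvx hwy this
  have key : ∀ (u : ∀ i, X i → ℂ) (a : X j), ∏ l ∈ s, u l (Function.update x j a l) =
      u j a * ∏ l ∈ s.erase j, u l (x l) := by
    intro u a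
    rw [← Finset.mul_prod_erase _ _ hj, Function.update_self]
    congr 1
    refine Finset.prod_congr rfl fun l hl => ?_
    rw [Function.update_of_ne (Finset.ne_of_mem_erase hl)]
  intro a b
  have := h (Function.update x j a) (Function.update x j b)
  simp only [key] at this
  rw [← Finset.mul_prod_erase _ _ hj] at hvx hwx
  have hne := mul_ne_zero (right_ne_zero_of_mul hvx) (right_ne_zero_of_mul hwx)
  apply mul_right_cancel₀ hne
  linear_combination this

variable [Fintype ι]

/-- The elementary tensor `⨂ v i`, as a function on the product of the index types. -/
noncomputable def pureTensor : MultilinearMap ℂ (fun i => X i → ℂ) ((∀ i, X i) → ℂ) :=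
  MultilinearMap.pi fun x =>
    (MultilinearMap.mkPiAlgebra ℂ ι ℂ).compLinearMap fun i => LinearMap.proj (x i)

theorem pureTensor_apply (v : ∀ i, X i → ℂ) (x : ∀ i, X i) :
    pureTensor v x = ∏ i, v i (x i) := by
  simp [pureTensor]

/-- Elementary tensors. -/
def IsPure (t : (∀ i, X i) → ℂ) : Prop := ∃ v, t = pureTensor v

theorem pureTensor_ne_zero {v : ∀ i, X i → ℂ} : pureTensor v ≠ 0 ↔ ∀ i, v i ≠ 0 := by
  constructor
  · intro h i hi
    exact h (pureTensor.map_coord_zero i hi)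
  · intro h
    have : ∀ i, ∃ x, v i x ≠ 0 := fun i => Function.ne_iff.mp (h i)
    choose x hx using this
    refine Function.ne_iff.mpr ⟨x, ?_⟩
    rw [pureTensor_apply]
    exact Finset.prod_ne_zero_iff.2 fun i _ => hx i

theorem pureTensor_eq_smul_of_parallel {v w : ∀ i, X i → ℂ} (hw : ∀ i, w i ≠ 0)
    (h : ∀ i, Parallel (v i) (w i)) : ∃ c : ℂ, pureTensor v = c • pureTensor w := by
  choose c hc using fun i => (h i).exists_smul (hw i)
  refine ⟨∏ i, c i, ?_⟩
  rw [← MultilinearMap.map_smul_univ]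
  congr 1
  ext i : 1
  exact hc i

variable [DecidableEq ι]

theorem pureTensor_update_point (v : ∀ i, X i → ℂ) (x : ∀ i, X i) (i : ι) (a : X i) :
    pureTensor v (Function.update x i a) = v i a * ∏ j ∈ Finset.univ.erase i, v j (x j) := by
  rw [pureTensor_apply, ← Finset.mul_prod_erase _ _ (Finset.mem_univ i)]
  rw [Function.update_self]
  congr 1
  refine Finset.prod_congr rfl fun j hj => ?_
  rw [Function.update_of_ne (Finset.ne_of_mem_erase hj)]

theorem parallel_of_pureTensor_eq_smul {v w : ∀ i, X i → ℂ} (hv : ∀ i, v i ≠ 0)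
    (hw : ∀ i, w i ≠ 0) {c : ℂ} (h : pureTensor v = c • pureTensor w) (j : ι) :
    Parallel (v j) (w j) := by
  refine parallel_of_prod_parallel (s := Finset.univ) hv hw ?_ (Finset.mem_univ j)
  intro x y
  have h1 := congrFun h x
  have h2 := congrFun h y
  simp only [pureTensor_apply, Pi.smul_apply, smul_eq_mul] at h1 h2
  rw [h1, h2]
  ring

theorem parallel_of_pureTensor_eq {v w : ∀ i, X i → ℂ} (hv : ∀ i, v i ≠ 0)
    (h : pureTensor v = pureTensor w) (j : ι) : Parallel (v j) (w j) := by
  have hw : ∀ i, w i ≠ 0 := pureTensor_ne_zero.1 (h ▸ pureTensor_ne_zero.2 hv)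
  exact parallel_of_pureTensor_eq_smul hv hw (c := 1) (by rw [one_smul, h]) j

/-- The scalars relating the parallel factors can all be moved into the factor `i`. -/
theorem pureTensor_eq_update_of_parallel {v w : ∀ i, X i → ℂ} {i : ι} (hw : ∀ j, j ≠ i → w j ≠ 0)
    (h : ∀ j, j ≠ i → Parallel (v j) (w j)) :
    ∃ b, pureTensor v = pureTensor (Function.update w i b) := by
  by_cases hv : v i = 0
  · refine ⟨0, ?_⟩
    rw [pureTensor.map_coord_zero i hv, pureTensor.map_update_zero]
  obtain ⟨c, hc⟩ := pureTensor_eq_smul_of_parallel (v := v) (w := Function.update w i (v i))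
    (by
      intro j
      rcases eq_or_ne j i with rfl | hj
      · simpa using hv
      · simpa [hj] using hw j hj)
    (by
      intro j
      rcases eq_or_ne j i with rfl | hj
      · simpa using Parallel.refl _
      · simpa [hj] using h j hj)
  exact ⟨c • v i, by rw [hc, pureTensor.map_update_smul]⟩

/-- If the sum of two elementary tensors is elementary, they differ in at most one factor. -/
theorem parallel_of_isPure_add {v w : ∀ i, X i → ℂ} (hv : ∀ i, v i ≠ 0) (hw : ∀ i, w i ≠ 0)
    (h : IsPure (pureTensor v + pureTensor w)) {i : ι} (hi : ¬ Parallel (v i) (w i))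
    {j : ι} (hj : j ≠ i) : Parallel (v j) (w j) := by
  obtain ⟨u, hu⟩ := h
  unfold Parallel at hi
  push Not at hi
  obtain ⟨a, b, hab⟩ := hi
  refine parallel_of_prod_parallel (s := Finset.univ.erase i) hv hw ?_
    (Finset.mem_erase.2 ⟨hj, Finset.mem_univ j⟩)
  intro x y
  have h1 := congrFun hu (Function.update x i a)
  have h2 := congrFun hu (Function.update x i b)
  have h3 := congrFun hu (Function.update y i a)
  have h4 := congrFun hu (Function.update y i b)
  simp only [Pi.add_apply, pureTensor_update_point] at h1 h2 h3 h4
  -- Both products have the same right-hand side, as the sum is elementary. Their difference factors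
  -- as the minor of `v i`, `w i` at `a`, `b` times the corresponding minor of the products over the
  -- other factors.
  have hE := congrArg₂ (· * ·) h1 h4
  have hF := congrArg₂ (· * ·) h2 h3
  apply mul_left_cancel₀ (sub_ne_zero.2 hab)
  linear_combination hE - hF

/-- Insertion of a vector into the factor `i` of an elementary tensor. -/
noncomputable abbrev insertFactor (w : ∀ i, X i → ℂ) (i : ι) :
    (X i → ℂ) →ₗ[ℂ] ((∀ i, X i) → ℂ) :=
  pureTensor.toLinearMap w i

theorem insertFactor_injective {w : ∀ i, X i → ℂ} {i : ι} (hw : ∀ j, j ≠ i → w j ≠ 0) :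
    Function.Injective (insertFactor w i) := by
  rw [injective_iff_map_eq_zero]
  intro a ha
  by_contra h0
  refine (pureTensor_ne_zero (v := Function.update w i a)).2 ?_ ha
  intro j
  rcases eq_or_ne j i with rfl | hj
  · simpa using h0
  · simpa [hj] using hw j hj

/-- A linear family of elementary tensors varies in a single factor. -/
theorem exists_insertFactor {Z : Type*} [Finite Z] [Nontrivial Z]
    {f : (Z → ℂ) →ₗ[ℂ] ((∀ i, X i) → ℂ)} (hf : Function.Injective f) {D : Set (Z → ℂ)}
    (hD : Submodule.span ℂ D = ⊤) (h1 : ∀ a ∈ D, IsPure (f a))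
    (h2 : ∀ a ∈ D, ∀ b ∈ D, IsPure (f (a + b))) :
    ∃ (w : ∀ i, X i → ℂ) (i : ι), (∀ j, w j ≠ 0) ∧ ∀ a, ∃ b, f a = insertFactor w i b := by
  classical
  have hf0 : ∀ {a}, a ≠ 0 → f a ≠ 0 := fun ha h0 => ha (hf (by simpa using h0))
  -- Two independent members of `D` fix the factor `i` in which their images differ; every other
  -- member is compared with both.
  obtain ⟨a₁, ha₁, ha₁0⟩ : ∃ a ∈ D, a ≠ 0 := by
    by_contra! h
    have : Submodule.span ℂ D ≤ ⊥ := Submodule.span_le.2 fun a ha => by simp [h a ha]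
    rw [hD, top_le_iff] at this
    exact bot_ne_top this
  obtain ⟨a₂, ha₂, ha₂p⟩ : ∃ a ∈ D, ¬ Parallel a a₁ := by
    by_contra! h
    have : Submodule.span ℂ D ≤ parallelPreimage LinearMap.id a₁ :=
      Submodule.span_le.2 fun a ha => h a ha
    rw [hD, top_le_iff] at this
    exact parallelPreimage_ne_top (α := LinearMap.id) Function.injective_id ha₁0 this
  have ha₂0 : a₂ ≠ 0 := by
    rintro rfl
    exact ha₂p fun x y => by simp
  obtain ⟨w, hw⟩ := h1 a₁ ha₁
  obtain ⟨w', hw'⟩ := h1 a₂ ha₂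
  have hw0 : ∀ i, w i ≠ 0 := pureTensor_ne_zero.1 (hw ▸ hf0 ha₁0)
  have hw'0 : ∀ i, w' i ≠ 0 := pureTensor_ne_zero.1 (hw' ▸ hf0 ha₂0)
  obtain ⟨i, hi⟩ : ∃ i, ¬ Parallel (w' i) (w i) := by
    by_contra! h
    obtain ⟨c, hc⟩ := pureTensor_eq_smul_of_parallel hw0 h
    rw [← hw, ← hw', ← map_smul] at hc
    exact ha₂p (hf hc ▸ parallel_smul c a₁)
  refine ⟨w, i, hw0, ?_⟩
  suffices hsub : Submodule.span ℂ D ≤ (LinearMap.range (insertFactor w i)).comap f by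
    intro a
    obtain ⟨b, hb⟩ := hsub (hD ▸ Submodule.mem_top : a ∈ Submodule.span ℂ D)
    exact ⟨b, hb.symm⟩
  refine Submodule.span_le.2 fun a ha => ?_
  by_cases ha0 : a = 0
  · simp [ha0]
  obtain ⟨u, hu⟩ := h1 a ha
  have hu0 : ∀ i, u i ≠ 0 := pureTensor_ne_zero.1 (hu ▸ hf0 ha0)
  have hww' : ∀ j, j ≠ i → Parallel (w' j) (w j) := fun j hj =>
    parallel_of_isPure_add hw'0 hw0 (by rw [← hw, ← hw', ← map_add]; exact h2 _ ha₂ _ ha₁) hi hj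
  have huw : ∀ j, j ≠ i → Parallel (u j) (w j) := by
    intro j hj
    -- If `u` differed from `w` in a factor `j ≠ i`, it would differ there from `w'` as well, so its
    -- factor `i` would be parallel to both `w i` and `w' i`, which are not parallel.
    by_contra hp
    have e1 : Parallel (u i) (w i) := parallel_of_isPure_add hu0 hw0
      (by rw [← hw, ← hu, ← map_add]; exact h2 _ ha _ ha₁) hp hj.symm
    have hp' : ¬ Parallel (u j) (w' j) := fun h => hp (h.trans (hw'0 j) (hww' j hj))
    have e2 : Parallel (u i) (w' i) := parallel_of_isPure_add hu0 hw'0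
      (by rw [← hw', ← hu, ← map_add]; exact h2 _ ha _ ha₂) hp' hj.symm
    exact hi (e2.symm.trans (hu0 i) e1)
  obtain ⟨b, hb⟩ := pureTensor_eq_update_of_parallel (fun j _ => hw0 j) huw
  exact ⟨b, by rw [hu, hb]; rfl⟩

end PureTensor

/-! ### Linear bijections preserving elementary tensors -/

section PureTensorPreserver

variable {ι : Type*} [DecidableEq ι] {X : ι → Type*}

/-- Two families of non-zero vectors are connected by changing one vector at a time. -/
theorem forall_of_forall_update [Finite ι] {R : (∀ i, X i → ℂ) → Prop}
    (h : ∀ v i a, (∀ j, v j ≠ 0) → a ≠ 0 → R v → R (Function.update v i a))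
    {v₀ : ∀ i, X i → ℂ} (h₀ : ∀ i, v₀ i ≠ 0) (hR : R v₀) {v : ∀ i, X i → ℂ}
    (hv : ∀ i, v i ≠ 0) : R v := by
  cases nonempty_fintype ι
  have key : ∀ s : Finset ι, R (s.piecewise v v₀) := by
    intro s
    induction s using Finset.induction_on with
    | empty => simpa using hR
    | insert i s _ ih =>
      rw [Finset.piecewise_insert]
      refine h _ _ _ (fun j => ?_) (hv i) ih
      by_cases hj : j ∈ s <;> simp [hj, hv, h₀]
  simpa using key Finset.univ

/-- For `a` not a multiple of `v`, comparing the scalars `c` at `a` and `d` at `a + v` gives `(c -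
d) a = (d - 1) v`, hence `c = d = 1`. This removes the scalar ambiguity left by parallelism. -/
theorem linearMap_eq_of_forall_exists_smul {V W : Type*} [AddCommGroup V] [Module ℂ V]
    [AddCommGroup W] [Module ℂ W] {g q : V →ₗ[ℂ] W} (hq : Function.Injective q)
    (h : ∀ a, ∃ c : ℂ, g a = c • q a) {v : V} (hv : v ≠ 0) (hgv : g v = q v) : g = q := by
  ext a
  by_cases ha : ∃ c : ℂ, a = c • v
  · obtain ⟨c, rfl⟩ := ha
    rw [map_smul, map_smul, hgv]
  obtain ⟨c, hc⟩ := h a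
  obtain ⟨d, hd⟩ := h (a + v)
  rw [map_add, hc, hgv, ← map_smul, ← map_smul, ← map_add] at hd
  have e := hq hd
  have e' : (c - d) • a = (d - 1) • v := by
    rw [sub_smul, sub_smul, sub_eq_sub_iff_add_eq_add, one_smul, e, smul_add, add_comm]
  have hcd : c - d = 0 := by
    by_contra hne
    exact ha ⟨(c - d)⁻¹ * (d - 1), by rw [mul_smul, ← e', inv_smul_smul₀ hne]⟩
  rw [hcd, zero_smul] at e'
  have hd1 : d - 1 = 0 := (smul_eq_zero.1 e'.symm).resolve_right hv
  have : c = 1 := by linear_combination hcd + hd1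
  rw [hc, this, one_smul]

variable [Fintype ι] [∀ i, Finite (X i)]

omit [DecidableEq ι] in
theorem span_isPure [∀ i, DecidableEq (X i)] :
    Submodule.span ℂ {t : (∀ i, X i) → ℂ | IsPure t} = ⊤ := by
  rw [eq_top_iff, ← (Pi.basisFun ℂ (∀ i, X i)).span_eq]
  refine Submodule.span_le.2 ?_
  rintro _ ⟨x, rfl⟩
  refine Submodule.subset_span ⟨fun i => Pi.single (x i) 1, ?_⟩
  ext y
  rw [pureTensor_apply, Pi.basisFun_apply]
  by_cases hxy : y = x
  · subst hxy
    simp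
  · obtain ⟨i, hi⟩ := Function.ne_iff.1 hxy
    rw [Pi.single_eq_of_ne hxy, Finset.prod_eq_zero (Finset.mem_univ i)]
    exact Pi.single_eq_of_ne hi _

variable [∀ i, Nontrivial (X i)]

/-- `Φ` maps the tensors obtained from `v` by varying the factor `i` to tensors that differ in the
factor `j` only. -/
def MovesFactor (Φ : ((∀ i, X i) → ℂ) →ₗ[ℂ] ((∀ i, X i) → ℂ)) (v : ∀ i, X i → ℂ) (i j : ι) :
    Prop :=
  ∃ w : ∀ i, X i → ℂ, (∀ l, w l ≠ 0) ∧ ∀ a, ∃ b, Φ (insertFactor v i a) = insertFactor w j b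

variable {Φ : ((∀ i, X i) → ℂ) →ₗ[ℂ] ((∀ i, X i) → ℂ)}

omit [∀ i, Finite (X i)] [∀ i, Nontrivial (X i)] in
-- Insertion into a factor is injective when the other factors are nonzero, so the inserted vector
-- is unique and therefore depends linearly on `a`.
theorem exists_linearMap_insertFactor {Z : Type*} {f : (Z → ℂ) →ₗ[ℂ] ((∀ i, X i) → ℂ)}
    (hf : Function.Injective f) {w : ∀ i, X i → ℂ} {j : ι} (hw : ∀ l, l ≠ j → w l ≠ 0)
    (h : ∀ a, ∃ b, f a = insertFactor w j b) :
    ∃ α : (Z → ℂ) →ₗ[ℂ] (X j → ℂ), Function.Injective α ∧ ∀ a, f a = insertFactor w j (α a) := by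
  have hinj := insertFactor_injective hw
  choose α hα using h
  refine ⟨⟨⟨α, fun a b => hinj ?_⟩, fun c a => hinj ?_⟩, fun a b hab => hf ?_, hα⟩
  · rw [← hα, map_add, map_add, hα, hα]
  · rw [← hα, map_smul, map_smul, hα, RingHom.id_apply]
  · rw [hα, hα]
    exact congrArg _ hab

omit [∀ i, Finite (X i)] [∀ i, Nontrivial (X i)] in
theorem comp_insertFactor_injective (hΦ : Function.Injective Φ) {v : ∀ i, X i → ℂ}
    (hv : ∀ i, v i ≠ 0) (i : ι) : Function.Injective (Φ ∘ₗ insertFactor v i) :=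
  hΦ.comp (insertFactor_injective fun j _ => hv j)

theorem exists_movesFactor (hΦ : Function.Injective Φ) (hp : ∀ v, IsPure (Φ (pureTensor v)))
    {v : ∀ i, X i → ℂ} (hv : ∀ i, v i ≠ 0) (i : ι) : ∃ j, MovesFactor Φ v i j := by
  obtain ⟨w, j, hw, h⟩ := exists_insertFactor (comp_insertFactor_injective hΦ hv i)
    (D := Set.univ) Submodule.span_univ (fun a _ => hp _) (fun a _ b _ => hp _)
  exact ⟨j, w, hw, h⟩

omit [∀ i, Finite (X i)] in
-- Suppose `j ≠ j'`. For generic `a` in factor `i`, the images at the two base points differ both in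
-- factor `j` and in factor `j'`. But their sum is the image of a single elementary tensor, with `v
-- l + c` in factor `l`, so they may differ in one factor only.
theorem MovesFactor.eq_of_update (hΦ : Function.Injective Φ)
    (hp : ∀ v, IsPure (Φ (pureTensor v))) {v : ∀ i, X i → ℂ} (hv : ∀ i, v i ≠ 0) {i l : ι}
    (hil : i ≠ l) {c : X l → ℂ} (hc : c ≠ 0) {j j' : ι} (h : MovesFactor Φ v i j)
    (h' : MovesFactor Φ (Function.update v l c) i j') : j = j' := by
  classical
  by_contra hj
  have hv' : ∀ i, Function.update v l c i ≠ 0 := by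
    intro k
    rcases eq_or_ne k l with rfl | hk
    · simpa using hc
    · simpa [hk] using hv k
  obtain ⟨w, hw, h⟩ := h
  obtain ⟨w', hw', h'⟩ := h'
  obtain ⟨α, hα, h⟩ := exists_linearMap_insertFactor (comp_insertFactor_injective hΦ hv i)
    (fun l _ => hw l) h
  obtain ⟨α', hα', h'⟩ := exists_linearMap_insertFactor (comp_insertFactor_injective hΦ hv' i)
    (fun l _ => hw' l) h'
  obtain ⟨a, ha, ha'⟩ := exists_notMem_of_ne_top (parallelPreimage_ne_top hα (hw' j))
    (parallelPreimage_ne_top hα' (hw j'))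
  have ha0 : a ≠ 0 := fun h0 => ha (h0 ▸ zero_mem _)
  have hα0 : α a ≠ 0 := fun h0 => ha0 (hα (by simpa using h0))
  have hα'0 : α' a ≠ 0 := fun h0 => ha0 (hα' (by simpa using h0))
  have hsum : insertFactor w j (α a) + insertFactor w' j' (α' a) =
      Φ (pureTensor (Function.update (Function.update v i a) l (v l + c))) := by
    rw [← h, ← h', pureTensor.map_update_add, map_add]
    congr 2
    · show Φ (pureTensor (Function.update v i a)) = _
      rw [← Function.update_of_ne hil.symm a v, Function.update_eq_self]
    · show Φ (pureTensor (Function.update (Function.update v l c) i a)) = _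
      rw [Function.update_comm hil]
  have hpar := parallel_of_isPure_add (v := Function.update w j (α a))
    (w := Function.update w' j' (α' a)) (i := j) (j := j')
    (by
      intro k
      rcases eq_or_ne k j with rfl | hk
      · simpa using hα0
      · simpa [hk] using hw k)
    (by
      intro k
      rcases eq_or_ne k j' with rfl | hk
      · simpa using hα'0
      · simpa [hk] using hw' k)
    (by
      have := hp (Function.update (Function.update v i a) l (v l + c))
      rwa [← hsum] at this)
    (by
      rw [Function.update_self, Function.update_of_ne hj]
      exact ha)
    (Ne.symm hj)
  rw [Function.update_self, Function.update_of_ne (Ne.symm hj)] at hpar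
  exact ha' hpar.symm

omit [∀ i, Finite (X i)] [∀ i, Nontrivial (X i)] in
theorem MovesFactor.update_self {v : ∀ i, X i → ℂ} {i j : ι} (h : MovesFactor Φ v i j)
    (c : X i → ℂ) : MovesFactor Φ (Function.update v i c) i j := by
  obtain ⟨w, hw, h⟩ := h
  refine ⟨w, hw, fun a => ?_⟩
  simpa using h a

/-- The factor that moves does not depend on the base point. -/
theorem exists_forall_movesFactor (hΦ : Function.Injective Φ)
    (hp : ∀ v, IsPure (Φ (pureTensor v))) (i : ι) :
    ∃ j, ∀ v : ∀ i, X i → ℂ, (∀ i, v i ≠ 0) → MovesFactor Φ v i j := by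
  have h₀ : ∀ i, (1 : X i → ℂ) ≠ 0 := fun i => one_ne_zero
  obtain ⟨j, hj⟩ := exists_movesFactor hΦ hp (v := fun _ => 1) h₀ i
  refine ⟨j, fun v hv => forall_of_forall_update (R := fun v => MovesFactor Φ v i j) ?_ h₀ hj hv⟩
  intro v l c hv hc h
  rcases eq_or_ne i l with rfl | hil
  · exact h.update_self c
  obtain ⟨j', hj'⟩ := exists_movesFactor hΦ hp (v := Function.update v l c) (by
    intro k
    rcases eq_or_ne k l with rfl | hk
    · simpa using hc
    · simpa [hk] using hv k) i
  rwa [h.eq_of_update hΦ hp hv hil hc hj']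

omit [∀ i, Finite (X i)] [∀ i, Nontrivial (X i)] in
/-- The factors other than the one that moves do not change. -/
theorem MovesFactor.parallel (hΦ : Function.Injective Φ) {v : ∀ i, X i → ℂ} (hv : ∀ i, v i ≠ 0)
    {i j : ι} (h : MovesFactor Φ v i j) {u u' : ∀ i, X i → ℂ} {a : X i → ℂ} (ha : a ≠ 0)
    (hu : Φ (pureTensor v) = pureTensor u)
    (hu' : Φ (pureTensor (Function.update v i a)) = pureTensor u') {l : ι} (hl : l ≠ j) :
    Parallel (u' l) (u l) := by
  obtain ⟨w, hw, h⟩ := h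
  obtain ⟨b, hb⟩ := h (v i)
  obtain ⟨b', hb'⟩ := h a
  have hv' : ∀ k, Function.update v i a k ≠ 0 := by
    intro k
    rcases eq_or_ne k i with rfl | hk
    · simpa using ha
    · simpa [hk] using hv k
  have hne : ∀ {v : ∀ i, X i → ℂ}, (∀ i, v i ≠ 0) → Φ (pureTensor v) ≠ 0 := fun hv h0 =>
    pureTensor_ne_zero.2 hv (hΦ (by simpa using h0))
  have hu0 : ∀ i, u i ≠ 0 := pureTensor_ne_zero.1 (hu ▸ hne hv)
  have hu'0 : ∀ i, u' i ≠ 0 := pureTensor_ne_zero.1 (hu' ▸ hne hv')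
  simp only [MultilinearMap.toLinearMap_apply, Function.update_eq_self] at hb hb'
  have h1 := parallel_of_pureTensor_eq hu0 (hu.symm.trans hb) l
  have h2 := parallel_of_pureTensor_eq hu'0 (hu'.symm.trans hb') l
  rw [Function.update_of_ne hl] at h1 h2
  exact h2.trans (hw l) h1.symm

/-- An invertible linear map that preserves elementary tensors is the composition of a permutation
of the factors and of injective linear maps in the factors. -/
theorem exists_perm_of_isPure (hΦ : Function.Bijective Φ)
    (hp : ∀ v, IsPure (Φ (pureTensor v))) :
    ∃ (σ : Equiv.Perm ι) (A : ∀ i, (X i → ℂ) →ₗ[ℂ] (X (σ i) → ℂ)),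
      (∀ i, Function.Injective (A i)) ∧
      ∀ v x, Φ (pureTensor v) x = ∏ i, A i (v i) (x (σ i)) := by
  classical
  have hne : ∀ {v : ∀ i, X i → ℂ}, (∀ i, v i ≠ 0) → Φ (pureTensor v) ≠ 0 := fun hv h0 =>
    pureTensor_ne_zero.2 hv (hΦ.1 (by simpa using h0))
  have hupd : ∀ {v : ∀ i, X i → ℂ} {i : ι} {a : X i → ℂ}, (∀ i, v i ≠ 0) → a ≠ 0 →
      ∀ k, Function.update v i a k ≠ 0 := by
    intro v i a hv ha k
    rcases eq_or_ne k i with rfl | hk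
    · simpa using ha
    · simpa [hk] using hv k
  choose u hu using hp
  have hp : ∀ v, IsPure (Φ (pureTensor v)) := fun v => ⟨u v, hu v⟩
  have hu0 : ∀ {v : ∀ i, X i → ℂ}, (∀ i, v i ≠ 0) → ∀ i, u v i ≠ 0 := fun hv =>
    pureTensor_ne_zero.1 (hu _ ▸ hne hv)
  choose s hs using exists_forall_movesFactor hΦ.1 hp
  set v₀ : ∀ i, X i → ℂ := fun _ => 1 with hv₀
  have h₀ : ∀ i, v₀ i ≠ 0 := fun i => one_ne_zero
  -- If no factor moved `j`, the factor `j` of every image would be constant up to scalars,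
  -- contradicting surjectivity of `Φ`.
  have hsurj : Function.Surjective s := by
    intro j
    by_contra! hj
    have hpar : ∀ v : ∀ i, X i → ℂ, (∀ i, v i ≠ 0) → Parallel (u v j) (u v₀ j) := by
      intro v hv
      refine forall_of_forall_update (R := fun v => Parallel (u v j) (u v₀ j)) ?_ h₀
        (Parallel.refl _) hv
      intro v i a hv ha h
      exact ((hs i v hv).parallel hΦ.1 hv ha (hu _) (hu _) (hj i).symm).trans (hu0 hv j) h
    -- The tensors all of whose slices in direction `j` are parallel to `u v₀ j`: a subspace that
    -- contains the range of `Φ`.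
    let p : Submodule ℂ ((∀ i, X i) → ℂ) :=
      { carrier := {t | ∀ x a b, t (Function.update x j a) * u v₀ j b =
          u v₀ j a * t (Function.update x j b)}
        zero_mem' := by simp
        add_mem' := by
          intro t t' h h' x a b
          have h1 := h x a b
          have h2 := h' x a b
          simp only [Pi.add_apply]
          linear_combination h1 + h2
        smul_mem' := by
          intro c t h x a b
          have h1 := h x a b
          simp only [Pi.smul_apply, smul_eq_mul]
          linear_combination c * h1 }
    have hmem : ∀ w : ∀ i, X i → ℂ, Parallel (w j) (u v₀ j) → pureTensor w ∈ p := by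
      intro w hw x a b
      have := hw a b
      rw [pureTensor_update_point, pureTensor_update_point]
      linear_combination (∏ k ∈ Finset.univ.erase j, w k (x k)) * this
    have htop : p = ⊤ := by
      have h1 : Submodule.comap Φ p = ⊤ := by
        rw [eq_top_iff, ← span_isPure]
        refine Submodule.span_le.2 ?_
        rintro _ ⟨v, rfl⟩
        by_cases hv : ∀ i, v i ≠ 0
        · show Φ (pureTensor v) ∈ p
          rw [hu]
          exact hmem _ (hpar v hv)
        · push Not at hv
          obtain ⟨i, hi⟩ := hv
          rw [pureTensor.map_coord_zero i hi]
          exact zero_mem _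
      rw [eq_top_iff]
      intro t _
      obtain ⟨t', rfl⟩ := hΦ.2 t
      exact (h1 ▸ Submodule.mem_top : t' ∈ Submodule.comap Φ p)
    have hall : ∀ a, Parallel a (u v₀ j) := by
      intro a x y
      have : pureTensor (Function.update v₀ j a) ∈ p := htop ▸ Submodule.mem_top
      have h1 := this (fun i => Classical.arbitrary (X i)) x y
      rw [pureTensor_update_point, pureTensor_update_point, Finset.prod_eq_one,
        Function.update_self, mul_one, mul_one] at h1
      · exact h1
      · intro k hk
        rw [Function.update_of_ne (Finset.ne_of_mem_erase hk)]
        rfl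
    obtain ⟨z, z', hz⟩ := exists_pair_ne (X j)
    exact not_parallel_single hz ((hall _).trans (hu0 h₀ j) (hall _).symm)
  have hbij : Function.Bijective s := Finite.injective_iff_bijective.1
    (Finite.injective_iff_surjective.2 hsurj)
  have hA : ∀ i, ∃ α : (X i → ℂ) →ₗ[ℂ] (X (s i) → ℂ), Function.Injective α ∧
      ∀ a, Φ (insertFactor v₀ i a) = insertFactor (u v₀) (s i) (α a) := by
    intro i
    refine exists_linearMap_insertFactor (comp_insertFactor_injective hΦ.1 h₀ i)
      (fun l _ => hu0 h₀ l) fun a => ?_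
    by_cases ha : a = 0
    · exact ⟨0, by simp [ha]⟩
    obtain ⟨b, hb⟩ := pureTensor_eq_update_of_parallel (v := u (Function.update v₀ i a))
      (w := u v₀) (i := s i) (fun l _ => hu0 h₀ l) fun l hl =>
        (hs i v₀ h₀).parallel hΦ.1 h₀ ha (hu _) (hu _) hl
    exact ⟨b, by
      simp only [LinearMap.comp_apply, MultilinearMap.toLinearMap_apply]
      rw [hu, hb]⟩
  choose A hAinj hA using hA
  refine ⟨Equiv.ofBijective s hbij, A, hAinj, ?_⟩
  have hAv₀ : ∀ i, A i (v₀ i) = u v₀ (s i) := by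
    intro i
    refine insertFactor_injective (w := u v₀) (fun l _ => hu0 h₀ l) ?_
    rw [← hA, MultilinearMap.toLinearMap_apply, MultilinearMap.toLinearMap_apply,
      Function.update_eq_self, Function.update_eq_self, hu]
  -- Once `v i` is inserted, changing another factor `l` moves only `s l ≠ s i`, so the comparison
  -- can be made at the base point `v₀`.
  have hpar : ∀ v : ∀ i, X i → ℂ, (∀ i, v i ≠ 0) → ∀ i,
      Parallel (u v (s i)) (A i (v i)) := by
    intro v hv i
    have key : ∀ {w : ∀ i, X i → ℂ}, (∀ i, w i ≠ 0) →
        Parallel (u (Function.update w i (v i)) (s i)) (A i (v i)) := by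
      intro w hw
      refine forall_of_forall_update
        (R := fun w => Parallel (u (Function.update w i (v i)) (s i)) (A i (v i))) ?_ h₀ ?_ hw
      · intro w l a hw ha h
        rcases eq_or_ne l i with rfl | hl
        · rwa [Function.update_idem]
        rw [Function.update_comm hl]
        have hw' := hupd (i := i) hw (hv i)
        exact ((hs l _ hw').parallel hΦ.1 hw' ha (hu _) (hu _)
          (hbij.1.ne hl.symm)).trans (hu0 hw' _) h
      · have h1 := parallel_of_pureTensor_eq (hu0 (hupd h₀ (hv i)))
          ((hu (Function.update v₀ i (v i))).symm.trans (hA i (v i))) (s i)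
        rwa [Function.update_self] at h1
    have := key hv
    rwa [Function.update_eq_self] at this
  set σ := Equiv.ofBijective s hbij
  let Q : MultilinearMap ℂ (fun i => X i → ℂ) ((∀ i, X i) → ℂ) :=
    MultilinearMap.pi fun x => (MultilinearMap.mkPiAlgebra ℂ ι ℂ).compLinearMap
      fun i => LinearMap.proj (x (s i)) ∘ₗ A i
  have hQ : ∀ v x, Q v x = ∏ i, A i (v i) (x (s i)) := by
    intro v x
    simp [Q]
  have hQ0 : ∀ {v : ∀ i, X i → ℂ}, (∀ i, v i ≠ 0) → Q v ≠ 0 := by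
    intro v hv
    have : ∀ i, ∃ x, A i (v i) x ≠ 0 := fun i =>
      Function.ne_iff.1 fun h0 => hv i (hAinj i (h0.trans (map_zero _).symm))
    choose x hx using this
    refine Function.ne_iff.2 ⟨Equiv.piCongrLeft X σ x, ?_⟩
    rw [hQ]
    refine Finset.prod_ne_zero_iff.2 fun i _ => ?_
    have := Equiv.piCongrLeft_apply_apply X σ x i
    change Equiv.piCongrLeft X σ x (s i) = x i at this
    rw [this]
    exact hx i
  have hΦu : ∀ {v : ∀ i, X i → ℂ} (x), Φ (pureTensor v) x = ∏ i, u v (s i) (x (s i)) := by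
    intro v x
    rw [hu, pureTensor_apply]
    exact (Equiv.prod_comp σ fun j => u v j (x j)).symm
  have hsmul : ∀ v : ∀ i, X i → ℂ, ∃ c : ℂ, Φ (pureTensor v) = c • Q v := by
    intro v
    by_cases hv : ∀ i, v i ≠ 0
    · choose c hc using fun i => (hpar v hv i).exists_smul
        fun h0 => hv i (hAinj i (h0.trans (map_zero _).symm))
      refine ⟨∏ i, c i, ?_⟩
      ext x
      rw [hΦu, Pi.smul_apply, hQ, smul_eq_mul, ← Finset.prod_mul_distrib]
      refine Finset.prod_congr rfl fun i _ => ?_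
      rw [hc i, Pi.smul_apply, smul_eq_mul]
    · push Not at hv
      obtain ⟨i, hi⟩ := hv
      exact ⟨0, by rw [pureTensor.map_coord_zero i hi, map_zero, zero_smul]⟩
  suffices hΦQ : ∀ v : ∀ i, X i → ℂ, (∀ i, v i ≠ 0) → Φ (pureTensor v) = Q v by
    intro v x
    refine (congrFun (?_ : Φ (pureTensor v) = Q v) x).trans (hQ v x)
    by_cases hv : ∀ i, v i ≠ 0
    · rw [hΦQ v hv]
    · push Not at hv
      obtain ⟨i, hi⟩ := hv
      rw [pureTensor.map_coord_zero i hi, Q.map_coord_zero i hi, map_zero]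
  intro v hv
  -- The equality is exact at `v₀` by `hAv₀`. When one factor changes, both sides are linear in it
  -- and proportional, so the scalar stays equal to `1`.
  refine forall_of_forall_update (R := fun v => Φ (pureTensor v) = Q v) ?_ h₀ ?_ hv
  · intro v i a hv ha h
    have hlin : Φ ∘ₗ insertFactor v i = Q.toLinearMap v i := by
      refine linearMap_eq_of_forall_exists_smul ?_ (fun b => hsmul _) (hv i) ?_
      · rw [injective_iff_map_eq_zero]
        intro b hb
        by_contra hb0
        exact hQ0 (hupd hv hb0) hb
      · simpa using h
    exact LinearMap.congr_fun hlin a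
  · ext x
    rw [hΦu, hQ]
    exact Finset.prod_congr rfl fun i _ => by rw [hAv₀]

end PureTensorPreserver

/-! ### The case of two factors -/

section TwoFactors

/-- The vector `a ⊗ b`. -/
def tensorVec {α β : Type*} (a : α → ℂ) (b : β → ℂ) : α × β → ℂ := fun p => a p.1 * b p.2

variable {α β : Type}

/-- The invertible linear maps on a space of bipartite vectors that preserve product vectors. -/
theorem tensorVec_preserver [Finite α] [Finite β] [Nontrivial α] [Nontrivial β]
    {Φ : (α × β → ℂ) →ₗ[ℂ] (α × β → ℂ)} (hΦ : Function.Bijective Φ)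
    (hp : ∀ a b, ∃ c d, Φ (tensorVec a b) = tensorVec c d) :
    (∃ (A : (α → ℂ) →ₗ[ℂ] (α → ℂ)) (B : (β → ℂ) →ₗ[ℂ] (β → ℂ)), Function.Injective A ∧
      Function.Injective B ∧ ∀ a b, Φ (tensorVec a b) = tensorVec (A a) (B b)) ∨
    (∃ (A : (α → ℂ) →ₗ[ℂ] (β → ℂ)) (B : (β → ℂ) →ₗ[ℂ] (α → ℂ)), Function.Injective A ∧
      Function.Injective B ∧ ∀ a b, Φ (tensorVec a b) = tensorVec (B b) (A a)) := by
  let X : Fin 2 → Type := ![α, β]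
  have hfin : ∀ i, Finite (X i) := Fin.forall_fin_two.2 ⟨‹Finite α›, ‹Finite β›⟩
  have hnt : ∀ i, Nontrivial (X i) := Fin.forall_fin_two.2 ⟨‹Nontrivial α›, ‹Nontrivial β›⟩
  let e : (∀ i, X i) ≃ α × β := piFinTwoEquiv X
  let E : (α × β → ℂ) ≃ₗ[ℂ] ((∀ i, X i) → ℂ) := LinearEquiv.funCongrLeft ℂ ℂ e
  have hE : ∀ (v : ∀ i, X i → ℂ), pureTensor v = E (tensorVec (v 0) (v 1)) := by
    intro v
    ext x
    rw [pureTensor_apply, Fin.prod_univ_two]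
    rfl
  have hE' : ∀ (a : α → ℂ) (b : β → ℂ), ∃ v : ∀ i, X i → ℂ, v 0 = a ∧ v 1 = b := fun a b =>
    ⟨Fin.cons a (Fin.cons b fun i => i.elim0), rfl, rfl⟩
  let Ψ : ((∀ i, X i) → ℂ) →ₗ[ℂ] ((∀ i, X i) → ℂ) := E.toLinearMap ∘ₗ Φ ∘ₗ E.symm.toLinearMap
  have hΨ : Function.Bijective Ψ := E.bijective.comp (hΦ.comp E.symm.bijective)
  have hΨE : ∀ t, Ψ (E t) = E (Φ t) := fun t => by simp [Ψ]
  obtain ⟨σ, A, hA, h⟩ := exists_perm_of_isPure hΨ (by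
    intro v
    obtain ⟨c, d, hcd⟩ := hp (v 0) (v 1)
    obtain ⟨w, rfl, rfl⟩ := hE' c d
    exact ⟨w, by rw [hE, hE, hΨE, hcd]⟩)
  have h' : ∀ (v : ∀ i, X i → ℂ) (x : ∀ i, X i), Φ (tensorVec (v 0) (v 1)) (e x) =
      A 0 (v 0) (x (σ 0)) * A 1 (v 1) (x (σ 1)) := by
    intro v x
    rw [← Fin.prod_univ_two fun i => A i (v i) (x (σ i)), ← h, hE, hΨE]
    rfl
  have hσ : σ = 1 ∨ σ = Equiv.swap 0 1 := by
    exact (by decide : ∀ σ : Equiv.Perm (Fin 2), σ = 1 ∨ σ = Equiv.swap 0 1) σ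
  rcases hσ with rfl | rfl
  · refine Or.inl ⟨A 0, A 1, hA 0, hA 1, fun a b => ?_⟩
    obtain ⟨v, rfl, rfl⟩ := hE' a b
    ext p
    obtain ⟨x, rfl⟩ := e.surjective p
    exact h' v x
  · refine Or.inr ⟨A 0, A 1, hA 0, hA 1, fun a b => ?_⟩
    obtain ⟨v, rfl, rfl⟩ := hE' a b
    ext p
    obtain ⟨x, rfl⟩ := e.surjective p
    exact (h' v x).trans (mul_comm _ _)

/-- A linear map that sends `D + D` to product vectors has only product vectors in its range. -/
theorem exists_tensorVec_of_span {Z : Type*} [Finite Z] [Nontrivial Z]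
    {f : (Z → ℂ) →ₗ[ℂ] (α × β → ℂ)} (hf : Function.Injective f) {D : Set (Z → ℂ)}
    (hD : Submodule.span ℂ D = ⊤) (h1 : ∀ a ∈ D, ∃ c d, f a = tensorVec c d)
    (h2 : ∀ a ∈ D, ∀ b ∈ D, ∃ c d, f (a + b) = tensorVec c d) (a : Z → ℂ) :
    ∃ c d, f a = tensorVec c d := by
  let X : Fin 2 → Type := ![α, β]
  let e : (∀ i, X i) ≃ α × β := piFinTwoEquiv X
  let E : (α × β → ℂ) ≃ₗ[ℂ] ((∀ i, X i) → ℂ) := LinearEquiv.funCongrLeft ℂ ℂ e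
  have hE : ∀ (v : ∀ i, X i → ℂ), pureTensor v = E (tensorVec (v 0) (v 1)) := by
    intro v
    ext x
    rw [pureTensor_apply, Fin.prod_univ_two]
    rfl
  have hpure : ∀ t, (∃ c d, t = tensorVec c d) → IsPure (E t) := by
    rintro _ ⟨c, d, rfl⟩
    exact ⟨_, (hE (Fin.cons c (Fin.cons d fun i => i.elim0))).symm⟩
  obtain ⟨w, i, -, h⟩ := exists_insertFactor (f := E.toLinearMap ∘ₗ f) (E.injective.comp hf) hD
    (fun a ha => hpure _ (h1 a ha)) (fun a ha b hb => hpure _ (h2 a ha b hb))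
  obtain ⟨b, hb⟩ := h a
  exact ⟨_, _, E.injective (hb.trans (hE _))⟩

end TwoFactors

/-! ### From matrices of rank at most `k` to matrices of rank at most one -/

section Rank

open Matrix

variable {α β : Type*} [Fintype α] [Fintype β]

omit [Fintype α] in
theorem rank_smul_le (c : ℂ) (A : Matrix α β ℂ) : (c • A).rank ≤ A.rank := by
  classical
  rw [show c • A = A * (c • (1 : Matrix β β ℂ)) by simp]
  exact rank_mul_le_left _ _

omit [Fintype α] in
theorem rank_add_le [Finite α] (A B : Matrix α β ℂ) : (A + B).rank ≤ A.rank + B.rank := by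
  unfold Matrix.rank
  rw [Matrix.mulVecLin_add]
  exact (Submodule.finrank_mono (LinearMap.range_add_le _ _)).trans
    (Submodule.finrank_add_le_finrank_add_finrank _ _)

omit [Fintype α] in
theorem eq_vecMulVec_of_rank_le_one [Finite α] {A : Matrix α β ℂ} (h : A.rank ≤ 1) :
    ∃ a b, A = vecMulVec a b := by
  classical
  unfold Matrix.rank at h
  obtain ⟨a, ha⟩ := finrank_le_one_iff.1 h
  choose c hc using ha
  refine ⟨a, fun j => c ⟨A.mulVecLin (Pi.single j 1), LinearMap.mem_range_self _ _⟩, ?_⟩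
  ext i j
  have := congrFun (congrArg Subtype.val
    (hc ⟨A.mulVecLin (Pi.single j 1), LinearMap.mem_range_self _ _⟩)) i
  rw [vecMulVec_apply, mul_comm]
  refine Eq.trans ?_ this.symm
  simp

omit [Fintype α] in
theorem exists_mulVec_eq_zero_of_rank_lt [Finite α] {A : Matrix α β ℂ}
    (h : A.rank < Fintype.card β) : ∃ w ≠ 0, A *ᵥ w = 0 := by
  have h1 := LinearMap.finrank_range_add_finrank_ker A.mulVecLin
  rw [Module.finrank_fintype_fun_eq_card] at h1
  have h2 : LinearMap.ker A.mulVecLin ≠ ⊥ := by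
    intro h0
    rw [h0, finrank_bot] at h1
    unfold Matrix.rank at h
    omega
  obtain ⟨w, hw, hw0⟩ := Submodule.exists_mem_ne_zero_of_ne_bot h2
  exact ⟨w, hw0, hw⟩

/-- Otherwise `B w` lies outside the range of `A`, which `u` annihilates. Adjoined to a basis `A vᵢ`
of that range it gives `A.rank + 1` independent vectors. Independence is an open condition, so for
small `t ≠ 0` the vectors `(A + t B) vᵢ` and `B w` are still independent, and they lie in the range
of `A + t B`. -/
theorem dotProduct_mulVec_eq_zero_of_rank_le {A B : Matrix α β ℂ}
    (h : ∀ t : ℂ, (A + t • B).rank ≤ A.rank) {u : α → ℂ} {w : β → ℂ} (hu : u ᵥ* A = 0)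
    (hw : A *ᵥ w = 0) : u ⬝ᵥ B *ᵥ w = 0 := by
  by_contra hne
  set k := A.rank with hk
  let b := Module.finBasisOfFinrankEq ℂ (LinearMap.range A.mulVecLin) (hk.symm : _ = k)
  have hb : ∀ i, ∃ v, A *ᵥ v = b i := fun i => (b i).2
  choose v hv using hb
  have hli : LinearIndependent ℂ fun i => A *ᵥ v i := by
    rw [show (fun i => A *ᵥ v i) = (LinearMap.range A.mulVecLin).subtype ∘ b from funext hv]
    exact b.linearIndependent.map' (Submodule.subtype _) (Submodule.ker_subtype _)
  let g : ℂ → Fin (k + 1) → α → ℂ := fun t => Fin.cons (B *ᵥ w) fun i => (A + t • B) *ᵥ v i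
  have hg0 : LinearIndependent ℂ (g 0) := by
    simp only [g, zero_smul, add_zero]
    rw [linearIndependent_finCons]
    refine ⟨hli, fun hmem => hne ?_⟩
    have hle : Submodule.span ℂ (Set.range fun i => A *ᵥ v i) ≤
        LinearMap.ker (dotProductBilin ℂ ℂ u) := by
      refine Submodule.span_le.2 ?_
      rintro _ ⟨i, rfl⟩
      show u ⬝ᵥ A *ᵥ v i = 0
      rw [dotProduct_mulVec, hu, zero_dotProduct]
    exact hle hmem
  have hgc : Continuous g := by
    refine continuous_pi fun i => ?_
    refine Fin.cases ?_ (fun i => ?_) i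
    · exact continuous_const
    · simp only [g, Fin.cons_succ, add_mulVec, smul_mulVec]
      fun_prop
  have hev : ∀ᶠ t in nhdsWithin (0 : ℂ) {0}ᶜ, LinearIndependent ℂ (g t) :=
    ((hgc.tendsto 0).eventually hg0.eventually).filter_mono nhdsWithin_le_nhds
  obtain ⟨t, ht, ht0⟩ := (hev.and self_mem_nhdsWithin).exists
  have ht0 : t ≠ 0 := ht0
  have hrange : Submodule.span ℂ (Set.range (g t)) ≤ LinearMap.range (A + t • B).mulVecLin := by
    refine Submodule.span_le.2 ?_
    rintro _ ⟨i, rfl⟩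
    refine Fin.cases ?_ (fun i => ?_) i
    -- As `A w = 0`, the vector `B w` equals `(A + t B) (t⁻¹ w)`; this is where `t ≠ 0` matters.
    · refine ⟨t⁻¹ • w, ?_⟩
      simp only [g, Fin.cons_zero, mulVecLin_apply, add_mulVec, mulVec_smul, smul_mulVec, hw]
      simp [smul_smul, ht0]
    · exact ⟨v i, rfl⟩
  have h1 := Submodule.finrank_mono hrange
  rw [finrank_span_eq_card ht, Fintype.card_fin] at h1
  have h2 := h t
  unfold Matrix.rank at h2
  omega

omit [Fintype α] in
theorem span_rank_le_one [Finite α] :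
    Submodule.span ℂ {B : Matrix α β ℂ | B.rank ≤ 1} = ⊤ := by
  classical
  cases nonempty_fintype α
  rw [eq_top_iff, ← (Matrix.stdBasis ℂ α β).span_eq]
  refine Submodule.span_le.2 ?_
  rintro _ ⟨⟨i, j⟩, rfl⟩
  refine Submodule.subset_span ?_
  rw [Set.mem_ofPred_eq, Matrix.stdBasis_eq_single, Matrix.single_eq_single_vecMulVec_single]
  exact rank_vecMulVec_le _ _

/-- If `A` had rank exactly `k`, there would be nonzero left and right null vectors `u`, `w`, as `k`
is below both dimensions. All admissible directions `B` would then satisfy `u ⬝ᵥ B w = 0`, which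
cuts out a proper subspace. -/
theorem rank_lt_of_span_eq_top {A : Matrix α β ℂ} {k : ℕ} (hα : k < Fintype.card α)
    (hβ : k < Fintype.card β) (hA : A.rank ≤ k)
    (h : Submodule.span ℂ {B : Matrix α β ℂ | ∀ t : ℂ, (A + t • B).rank ≤ k} = ⊤) :
    A.rank < k := by
  classical
  refine lt_of_le_of_ne hA fun hk => ?_
  subst hk
  obtain ⟨w, hw0, hw⟩ := exists_mulVec_eq_zero_of_rank_lt hβ
  obtain ⟨u, hu0, hu⟩ := exists_mulVec_eq_zero_of_rank_lt (A := Aᵀ) (by rwa [rank_transpose])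
  rw [mulVec_transpose] at hu
  obtain ⟨i, hi⟩ := Function.ne_iff.1 hu0
  obtain ⟨j, hj⟩ := Function.ne_iff.1 hw0
  let p : Submodule ℂ (Matrix α β ℂ) :=
    { carrier := {B | u ⬝ᵥ B *ᵥ w = 0}
      zero_mem' := by simp
      add_mem' := by
        intro B C hB hC
        simp only [Set.mem_ofPred_eq] at *
        rw [add_mulVec, dotProduct_add, hB, hC, add_zero]
      smul_mem' := by
        intro c B hB
        simp only [Set.mem_ofPred_eq] at *
        rw [smul_mulVec, dotProduct_smul, hB, smul_zero] }
  have hle : Submodule.span ℂ {B : Matrix α β ℂ | ∀ t : ℂ, (A + t • B).rank ≤ A.rank} ≤ p :=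
    Submodule.span_le.2 fun B hB => dotProduct_mulVec_eq_zero_of_rank_le hB hu hw
  rw [h] at hle
  have : u ⬝ᵥ (Matrix.single i j 1) *ᵥ w = 0 := hle Submodule.mem_top
  simp [single_mulVec, Function.update_apply, dotProduct] at this
  exact this.elim hi hj

/-- A surjective linear map that preserves the matrices of rank at most `k + 1` preserves those of
rank at most `k`. -/
theorem rank_le_of_rank_le_succ {Φ : Matrix α β ℂ →ₗ[ℂ] Matrix α β ℂ}
    (hΦ : Function.Surjective Φ) {k : ℕ} (hα : k + 1 < Fintype.card α)
    (hβ : k + 1 < Fintype.card β) (h : ∀ A, A.rank ≤ k + 1 → (Φ A).rank ≤ k + 1)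
    {A : Matrix α β ℂ} (hA : A.rank ≤ k) : (Φ A).rank ≤ k := by
  refine Nat.lt_succ_iff.1 (rank_lt_of_span_eq_top hα hβ (h A (by omega)) ?_)
  -- Since `A` has rank at most `k`, every `B` of rank at most one is an admissible direction, and
  -- these span.
  have h1 : Submodule.span ℂ {B : Matrix α β ℂ | ∀ t : ℂ, (A + t • B).rank ≤ k + 1} = ⊤ := by
    rw [eq_top_iff, ← span_rank_le_one]
    refine Submodule.span_mono fun B hB t => ?_
    refine (rank_add_le _ _).trans (add_le_add hA ((rank_smul_le _ _).trans hB))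
  -- `Φ` carries admissible directions at `A` to admissible directions at `Φ A`; by surjectivity
  -- their images span.
  rw [eq_top_iff, ← LinearMap.range_eq_top.2 hΦ, LinearMap.range_eq_map, ← h1,
    Submodule.map_span]
  refine Submodule.span_mono ?_
  rintro _ ⟨B, hB, rfl⟩ t
  rw [← map_smul, ← map_add]
  exact h _ (hB t)

theorem rank_le_one_of_rank_le {Φ : Matrix α β ℂ →ₗ[ℂ] Matrix α β ℂ}
    (hΦ : Function.Surjective Φ) {k : ℕ} (hk : 1 ≤ k) (hα : k < Fintype.card α)
    (hβ : k < Fintype.card β) (h : ∀ A, A.rank ≤ k → (Φ A).rank ≤ k)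
    {A : Matrix α β ℂ} (hA : A.rank ≤ 1) : (Φ A).rank ≤ 1 := by
  induction k, hk using Nat.le_induction generalizing A with
  | base => exact h A hA
  | succ k _ ih =>
    exact ih (by omega) (by omega) (fun A hA => rank_le_of_rank_le_succ hΦ hα hβ h hA) hA

end Rank

/-! ### Bipartite vectors, the swap and Schmidt-rank preservers -/

section BipartiteVectors

open Matrix

/-- The matrix of coordinates of a bipartite vector. -/
def coordMatrix {α β : Type*} : (α × β → ℂ) ≃ₗ[ℂ] Matrix α β ℂ :=
  (LinearEquiv.curry ℂ ℂ α β).trans (Matrix.ofLinearEquiv ℂ)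

theorem coordMatrix_apply {α β : Type*} (x : α × β → ℂ) (i : α) (j : β) :
    coordMatrix x i j = x (i, j) := rfl

theorem coordMatrix_tensorVec {α β : Type*} (a : α → ℂ) (b : β → ℂ) :
    coordMatrix (tensorVec a b) = vecMulVec a b := rfl

theorem rank_tensorVec_le {α β : Type*} [Fintype β] (a : α → ℂ) (b : β → ℂ) :
    (coordMatrix (tensorVec a b)).rank ≤ 1 :=
  rank_vecMulVec_le _ _

theorem exists_eq_tensorVec {α β : Type*} [Finite α] [Fintype β] {x : α × β → ℂ}
    (hx : (coordMatrix x).rank ≤ 1) : ∃ a b, x = tensorVec a b := by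
  obtain ⟨a, b, h⟩ := eq_vecMulVec_of_rank_le_one hx
  exact ⟨a, b, coordMatrix.injective h⟩

theorem tensorVec_ne_zero {α β : Type*} {a : α → ℂ} {b : β → ℂ} (ha : a ≠ 0) (hb : b ≠ 0) :
    tensorVec a b ≠ 0 := by
  obtain ⟨i, hi⟩ := Function.ne_iff.1 ha
  obtain ⟨j, hj⟩ := Function.ne_iff.1 hb
  exact Function.ne_iff.2 ⟨(i, j), mul_ne_zero hi hj⟩

/-- The bilinear map `(a, b) ↦ a ⊗ b`. -/
def tensorVecBilin (α β : Type*) : (α → ℂ) →ₗ[ℂ] (β → ℂ) →ₗ[ℂ] (α × β → ℂ) :=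
  LinearMap.mk₂ ℂ tensorVec
    (fun _ _ _ => funext fun _ => add_mul _ _ _)
    (fun _ _ _ => funext fun _ => mul_assoc _ _ _)
    (fun _ _ _ => funext fun _ => mul_add _ _ _)
    (fun _ _ _ => funext fun _ => mul_left_comm _ _ _)

theorem tensorVec_left_injective {α β : Type*} {b : β → ℂ} (hb : b ≠ 0) :
    Function.Injective ((tensorVecBilin α β).flip b) := by
  rw [injective_iff_map_eq_zero]
  intro a ha
  by_contra h0
  exact tensorVec_ne_zero h0 hb ha

theorem tensorVec_right_injective {α β : Type*} {a : α → ℂ} (ha : a ≠ 0) :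
    Function.Injective (tensorVecBilin α β a) := by
  rw [injective_iff_map_eq_zero]
  intro b hb
  by_contra h0
  exact tensorVec_ne_zero ha h0 hb

theorem linearMap_eq_of_tensorVec {α β W : Type*} [Finite α] [Finite β] [AddCommGroup W]
    [Module ℂ W] {f g : (α × β → ℂ) →ₗ[ℂ] W}
    (h : ∀ a b, f (tensorVec a b) = g (tensorVec a b)) : f = g := by
  classical
  refine (Pi.basisFun ℂ (α × β)).ext fun p => ?_
  have : Pi.single p (1 : ℂ) = tensorVec (Pi.single p.1 1) (Pi.single p.2 1) := by
    ext q
    simp only [tensorVec, Pi.single_apply, Prod.ext_iff]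
    split_ifs <;> simp_all
  rw [Pi.basisFun_apply, this, h]

theorem linearMap_eq_of_vecMulVec {α β W : Type*} [Finite α] [Finite β] [AddCommGroup W]
    [Module ℂ W] {f g : Matrix α β ℂ →ₗ[ℂ] W}
    (h : ∀ a b, f (vecMulVec a b) = g (vecMulVec a b)) : f = g := by
  have : f ∘ₗ coordMatrix.toLinearMap = g ∘ₗ coordMatrix.toLinearMap :=
    linearMap_eq_of_tensorVec h
  ext1 X
  obtain ⟨x, rfl⟩ := coordMatrix.surjective X
  exact LinearMap.congr_fun this x

theorem span_coordMatrix_rank_le_one {α β : Type*} [Finite α] [Fintype β] :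
    Submodule.span ℂ {x : α × β → ℂ | (coordMatrix x).rank ≤ 1} = ⊤ := by
  have h := congrArg (Submodule.map (coordMatrix (α := α) (β := β)).symm.toLinearMap)
    (span_rank_le_one (α := α) (β := β))
  rw [Submodule.map_span, Submodule.map_top, LinearEquiv.range] at h
  rw [← h]
  congr 1
  ext x
  constructor
  · exact fun hx => ⟨coordMatrix x, hx, by simp⟩
  · rintro ⟨A, hA, rfl⟩
    simpa using hA

theorem coordMatrix_kronecker_mulVec {α β γ δ : Type*} [Fintype α] [Fintype β]
    (P : Matrix γ α ℂ) (Q : Matrix δ β ℂ) (x : α × β → ℂ) :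
    coordMatrix ((P ⊗ₖ Q) *ᵥ x) = P * coordMatrix x * Qᵀ := by
  ext i j
  simp only [coordMatrix_apply, mulVec, dotProduct, kroneckerMap_apply, mul_apply,
    transpose_apply, Fintype.sum_prod_type, Finset.sum_mul]
  rw [Finset.sum_comm]
  exact Finset.sum_congr rfl fun b _ => Finset.sum_congr rfl fun a _ => by ring

theorem kronecker_mulVec_tensorVec {α β γ δ : Type*} [Fintype α] [Fintype β]
    (P : Matrix γ α ℂ) (Q : Matrix δ β ℂ) (a : α → ℂ) (b : β → ℂ) :
    (P ⊗ₖ Q) *ᵥ tensorVec a b = tensorVec (P *ᵥ a) (Q *ᵥ b) := by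
  apply coordMatrix.injective
  rw [coordMatrix_kronecker_mulVec, coordMatrix_tensorVec, coordMatrix_tensorVec,
    mul_vecMulVec, vecMulVec_mul, vecMul_transpose]

theorem swapOperator_eq_submatrix (n : ℕ) :
    swapOperator n n = (1 : BipartiteOp n n).submatrix Prod.swap id := by
  ext p q
  simp only [swapOperator, of_apply, submatrix_apply, one_apply, Prod.ext_iff, Prod.fst_swap,
    Prod.snd_swap, id, Fin.ext_iff]
  simp only [and_comm]

theorem swapOperator_mul {n : ℕ} (M : BipartiteOp n n) :
    swapOperator n n * M = M.submatrix Prod.swap id := by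
  ext p q
  simp [swapOperator_eq_submatrix, mul_apply, one_apply]

theorem mul_swapOperator {n : ℕ} (M : BipartiteOp n n) :
    M * swapOperator n n = M.submatrix id Prod.swap := by
  ext p q
  simp only [swapOperator_eq_submatrix, mul_apply, submatrix_apply, one_apply, id]
  rw [Finset.sum_eq_single q.swap]
  · simp
  · intro r _ hr
    rw [if_neg, mul_zero]
    rintro rfl
    simp at hr
  · simp

theorem swapOperator_mulVec_apply {n : ℕ} (x : Fin n × Fin n → ℂ) (p : Fin n × Fin n) :
    (swapOperator n n *ᵥ x) p = x p.swap := by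
  simp [swapOperator_eq_submatrix, mulVec, dotProduct, one_apply]

theorem IsLocalOrSwap.transpose {m n : ℕ} {L : BipartiteOp m n} (hL : IsLocalOrSwap L) :
    IsLocalOrSwap Lᵀ := by
  obtain ⟨P, Q, hP, hQ, rfl | ⟨rfl, rfl⟩⟩ := hL
  · exact ⟨Pᵀ, Qᵀ, (isUnit_transpose P).2 hP, (isUnit_transpose Q).2 hQ,
      Or.inl (by ext p q; simp [kroneckerMap_apply])⟩
  · refine ⟨Qᵀ, Pᵀ, (isUnit_transpose Q).2 hQ, (isUnit_transpose P).2 hP, Or.inr ⟨rfl, ?_⟩⟩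
    rw [swapOperator_mul, swapOperator_mul]
    ext p q
    simp [kroneckerMap_apply, mul_comm]

theorem IsLocalOrSwap.rank_mulVec_le {m n : ℕ} {L : BipartiteOp m n} (hL : IsLocalOrSwap L)
    (x : Fin m × Fin n → ℂ) : (coordMatrix (L *ᵥ x)).rank ≤ (coordMatrix x).rank := by
  obtain ⟨P, Q, hP, hQ, rfl | ⟨rfl, rfl⟩⟩ := hL
  · rw [coordMatrix_kronecker_mulVec]
    exact (rank_mul_le_left _ _).trans (rank_mul_le_right _ _)
  · have : coordMatrix ((swapOperator n n * P ⊗ₖ Q) *ᵥ x) =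
        (coordMatrix ((P ⊗ₖ Q) *ᵥ x))ᵀ := by
      ext i j
      rw [← mulVec_mulVec, coordMatrix_apply, swapOperator_mulVec_apply]
      rfl
    rw [this, rank_transpose, coordMatrix_kronecker_mulVec]
    exact (rank_mul_le_left _ _).trans (rank_mul_le_right _ _)

theorem isUnit_toMatrix'_of_injective {n : ℕ} {A : (Fin n → ℂ) →ₗ[ℂ] (Fin n → ℂ)}
    (hA : Function.Injective A) : IsUnit (LinearMap.toMatrix' A) := by
  rw [← mulVec_injective_iff_isUnit]
  intro x y hxy
  exact hA (by simpa using hxy)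

/-- The invertible linear maps that preserve the vectors of Schmidt rank at most `k`. -/
theorem exists_isLocalOrSwap {k m n : ℕ} (hk : 1 ≤ k) (hm : k < m) (hn : k < n)
    {A : (Fin m × Fin n → ℂ) →ₗ[ℂ] (Fin m × Fin n → ℂ)} (hA : Function.Injective A)
    (h : ∀ x, (coordMatrix x).rank ≤ k → (coordMatrix (A x)).rank ≤ k) :
    ∃ L : BipartiteOp m n, IsLocalOrSwap L ∧ ∀ x, A x = L *ᵥ x := by
  have : Nontrivial (Fin m) := Fin.nontrivial_iff_two_le.2 (by omega)
  have : Nontrivial (Fin n) := Fin.nontrivial_iff_two_le.2 (by omega)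
  have hsurj : Function.Surjective A := LinearMap.injective_iff_surjective.1 hA
  let Φ : Matrix (Fin m) (Fin n) ℂ →ₗ[ℂ] Matrix (Fin m) (Fin n) ℂ :=
    coordMatrix.toLinearMap ∘ₗ A ∘ₗ coordMatrix.symm.toLinearMap
  have hΦ : Function.Surjective Φ :=
    coordMatrix.surjective.comp (hsurj.comp coordMatrix.symm.surjective)
  have hp : ∀ a b, ∃ c d, A (tensorVec a b) = tensorVec c d := by
    intro a b
    refine exists_eq_tensorVec ?_
    have := rank_le_one_of_rank_le hΦ hk (by simpa using hm) (by simpa using hn)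
      (fun B hB => h _ (by simpa using hB)) (rank_tensorVec_le a b)
    simpa [Φ] using this
  rcases tensorVec_preserver ⟨hA, hsurj⟩ hp with ⟨P, Q, hP, hQ, hPQ⟩ | ⟨P, Q, hP, hQ, hPQ⟩
  · refine ⟨_, ⟨P.toMatrix', Q.toMatrix', isUnit_toMatrix'_of_injective hP,
      isUnit_toMatrix'_of_injective hQ, Or.inl rfl⟩, fun x => ?_⟩
    refine LinearMap.congr_fun (linearMap_eq_of_tensorVec (g := mulVecLin _) fun a b => ?_) x
    rw [hPQ, mulVecLin_apply, kronecker_mulVec_tensorVec, LinearMap.toMatrix'_mulVec,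
      LinearMap.toMatrix'_mulVec]
  -- Exchanging the factors needs injective maps in both directions, so the dimensions agree.
  · have hmn : m ≤ n := by simpa using LinearMap.finrank_le_finrank_of_injective hP
    have hnm : n ≤ m := by simpa using LinearMap.finrank_le_finrank_of_injective hQ
    obtain rfl := le_antisymm hmn hnm
    refine ⟨_, ⟨P.toMatrix', Q.toMatrix', isUnit_toMatrix'_of_injective hP,
      isUnit_toMatrix'_of_injective hQ, Or.inr ⟨rfl, rfl⟩⟩, fun x => ?_⟩
    refine LinearMap.congr_fun (linearMap_eq_of_tensorVec (g := mulVecLin _) fun a b => ?_) x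
    rw [hPQ, mulVecLin_apply, ← mulVec_mulVec, kronecker_mulVec_tensorVec,
      LinearMap.toMatrix'_mulVec, LinearMap.toMatrix'_mulVec]
    ext p
    rw [swapOperator_mulVec_apply]
    exact mul_comm _ _

end BipartiteVectors

/-! ### Operators of the set and compositions of building blocks -/

section BipartiteOperators

open Matrix

open scoped ComplexOrder in
-- Norms are absorbed in `c`, and entrywise conjugation does not change the rank. The resulting
-- description by `x yᵀ` is bilinear, free of norms and conjugates.
theorem mem_rankOneSchmidt_iff {k m n : ℕ} (hk : 1 ≤ k) (hm : 0 < m) (hn : 0 < n)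
    {X : BipartiteOp m n} : X ∈ rankOneSchmidt k m n ↔ ∃ x y : Fin m × Fin n → ℂ,
      (coordMatrix x).rank ≤ k ∧ (coordMatrix y).rank ≤ k ∧ X = vecMulVec x y := by
  have hstar : ∀ x : Fin m × Fin n → ℂ, (coordMatrix (star x)).rank = (coordMatrix x).rank := by
    intro x
    rw [← rank_conjTranspose, ← rank_transpose]
    congr 1
    ext i j
    simp [coordMatrix_apply]
  constructor
  · rintro ⟨c, v, w, -, -, hv, hw, rfl⟩
    refine ⟨(c : ℂ) • v.ofLp, star w.ofLp, ?_, ?_, ?_⟩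
    · rw [map_smul]
      exact (rank_smul_le _ _).trans hv
    · rw [hstar]
      exact hw
    · ext p q
      simp [ketBra, vecMulVec_apply, mul_assoc]
  · have hunit : ∀ x : Fin m × Fin n → ℂ, (coordMatrix x).rank ≤ k → x ≠ 0 →
        ∃ (c : ℝ) (v : BipartiteVec m n), ‖v‖ = 1 ∧ schmidtRank v ≤ k ∧
          x = (c : ℂ) • v.ofLp := by
      intro x hx hx0
      have hne : ‖WithLp.toLp 2 x‖ ≠ 0 := by
        rw [norm_ne_zero_iff]
        simpa using hx0
      refine ⟨‖WithLp.toLp 2 x‖, WithLp.toLp 2 (((‖WithLp.toLp 2 x‖⁻¹ : ℝ) : ℂ) • x), ?_, ?_, ?_⟩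
      · rw [WithLp.toLp_smul, norm_smul, Complex.norm_real, norm_inv, norm_norm,
          inv_mul_cancel₀ hne]
      · refine le_trans ?_ ((rank_smul_le ((‖WithLp.toLp 2 x‖⁻¹ : ℝ) : ℂ) _).trans hx)
        rw [← map_smul]
        exact le_rfl
      · rw [smul_smul, ← Complex.ofReal_mul, mul_inv_cancel₀ hne, Complex.ofReal_one, one_smul]
    rintro ⟨x, y, hx, hy, rfl⟩
    by_cases hx0 : x = 0 ∨ y = 0
    -- The zero operator also has to be written with unit vectors: `c = 0` and the normalised
    -- all-ones product vector, which needs `1 ≤ k`.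
    · obtain ⟨c, v, hv, hvk, -⟩ := hunit (tensorVec 1 1) ((rank_tensorVec_le _ _).trans hk)
        (Function.ne_iff.2 ⟨(⟨0, hm⟩, ⟨0, hn⟩), by simp [tensorVec]⟩)
      refine ⟨0, v, v, hv, hv, hvk, hvk, ?_⟩
      rcases hx0 with rfl | rfl <;> simp
    · push Not at hx0
      obtain ⟨c, v, hv, hvk, hcv⟩ := hunit x hx hx0.1
      obtain ⟨d, w, hw, hwk, hdw⟩ := hunit (star y) (by rwa [hstar]) (star_ne_zero.2 hx0.2)
      refine ⟨c * d, v, w, hv, hw, hvk, hwk, ?_⟩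
      ext p q
      have h1 := congrFun hcv p
      have h2 := congrArg star (congrFun hdw q)
      simp only [Pi.star_apply, star_star, Pi.smul_apply, smul_eq_mul, star_mul'] at h1 h2
      rw [vecMulVec_apply, h1, h2]
      simp [ketBra]
      ring

theorem partialTranspose_vecMulVec {m n : ℕ} (a c : Fin m → ℂ) (b d : Fin n → ℂ) :
    partialTranspose (vecMulVec (tensorVec a b) (tensorVec c d)) =
      vecMulVec (tensorVec a d) (tensorVec c b) := by
  ext p q
  simp only [partialTranspose, of_apply, vecMulVec_apply, tensorVec]
  ring

theorem IsBasicPreserver.map_mem {k m n : ℕ} (hk : 1 ≤ k) (hm : 0 < m) (hn : 0 < n)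
    {Ψ : Module.End ℂ (BipartiteOp m n)} (hΨ : IsBasicPreserver k Ψ) {X : BipartiteOp m n}
    (hX : X ∈ rankOneSchmidt k m n) : Ψ X ∈ rankOneSchmidt k m n := by
  rw [mem_rankOneSchmidt_iff hk hm hn] at hX ⊢
  obtain ⟨x, y, hx, hy, rfl⟩ := hX
  rcases hΨ with ⟨L, M, hL, hM, h⟩ | h | ⟨rfl, h⟩
  · refine ⟨L *ᵥ x, Mᵀ *ᵥ y, (hL.rank_mulVec_le x).trans hx,
      (hM.transpose.rank_mulVec_le y).trans hy, ?_⟩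
    rw [h, mul_vecMulVec, vecMulVec_mul, mulVec_transpose]
  · exact ⟨y, x, hy, hx, by rw [h, transpose_vecMulVec]⟩
  · obtain ⟨a, b, rfl⟩ := exists_eq_tensorVec hx
    obtain ⟨c, d, rfl⟩ := exists_eq_tensorVec hy
    exact ⟨_, _, rank_tensorVec_le a d, rank_tensorVec_le c b, by
      rw [h, partialTranspose_vecMulVec]⟩

/-- Compositions of one or more basic preservers. -/
def IsPreserverComp (k : ℕ) {m n : ℕ} (Ψ : Module.End ℂ (BipartiteOp m n)) : Prop :=
  ∃ l : List (Module.End ℂ (BipartiteOp m n)),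
    l ≠ [] ∧ (∀ Ψ ∈ l, IsBasicPreserver k Ψ) ∧ Ψ = l.prod

theorem IsBasicPreserver.isPreserverComp {k m n : ℕ} {Ψ : Module.End ℂ (BipartiteOp m n)}
    (h : IsBasicPreserver k Ψ) : IsPreserverComp k Ψ :=
  ⟨[Ψ], by simp, by simpa using h, by simp⟩

theorem IsPreserverComp.mul {k m n : ℕ} {Ψ Ψ' : Module.End ℂ (BipartiteOp m n)}
    (h : IsPreserverComp k Ψ) (h' : IsPreserverComp k Ψ') : IsPreserverComp k (Ψ * Ψ') := by
  obtain ⟨l, hl, hlb, rfl⟩ := h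
  obtain ⟨l', -, hlb', rfl⟩ := h'
  refine ⟨l ++ l', by simp [hl], fun Ψ hΨ => ?_, by simp⟩
  rcases List.mem_append.1 hΨ with h | h
  · exact hlb _ h
  · exact hlb' _ h

theorem IsPreserverComp.map_mem {k m n : ℕ} (hk : 1 ≤ k) (hm : 0 < m) (hn : 0 < n)
    {Ψ : Module.End ℂ (BipartiteOp m n)} (hΨ : IsPreserverComp k Ψ) {X : BipartiteOp m n}
    (hX : X ∈ rankOneSchmidt k m n) : Ψ X ∈ rankOneSchmidt k m n := by
  obtain ⟨l, -, hl, rfl⟩ := hΨ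
  induction l with
  | nil => simpa using hX
  | cons Ψ l ih =>
    rw [List.prod_cons]
    exact (hl Ψ (by simp)).map_mem hk hm hn (ih fun Ψ' h => hl Ψ' (by simp [h]))

/-- The map `X ↦ L X M`. -/
def mulLeftRight {m n : ℕ} (L M : BipartiteOp m n) : Module.End ℂ (BipartiteOp m n) :=
  LinearMap.mulLeft ℂ L ∘ₗ LinearMap.mulRight ℂ M

theorem mulLeftRight_apply {m n : ℕ} (L M X : BipartiteOp m n) :
    mulLeftRight L M X = L * X * M :=
  (mul_assoc _ _ _).symm

theorem isPreserverComp_mulLeftRight {k m n : ℕ} {L M : BipartiteOp m n} (hL : IsLocalOrSwap L)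
    (hM : IsLocalOrSwap M) : IsPreserverComp k (mulLeftRight L M) :=
  IsBasicPreserver.isPreserverComp (Or.inl ⟨L, M, hL, hM, mulLeftRight_apply L M⟩)

/-- The transpose as a linear map. -/
def transposeLinear (m n : ℕ) : Module.End ℂ (BipartiteOp m n) where
  toFun X := Xᵀ
  map_add' _ _ := rfl
  map_smul' _ _ := rfl

theorem isPreserverComp_transpose (k m n : ℕ) : IsPreserverComp k (transposeLinear m n) :=
  IsBasicPreserver.isPreserverComp (Or.inr (Or.inl fun _ => rfl))

/-- The partial transpose as a linear map. -/
def partialTransposeLinear (m n : ℕ) : Module.End ℂ (BipartiteOp m n) where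
  toFun := partialTranspose
  map_add' _ _ := rfl
  map_smul' _ _ := rfl

theorem isPreserverComp_partialTranspose (m n : ℕ) :
    IsPreserverComp 1 (partialTransposeLinear m n) :=
  IsBasicPreserver.isPreserverComp (Or.inr (Or.inr ⟨rfl, fun _ => rfl⟩))

theorem isLocalOrSwap_one (m n : ℕ) : IsLocalOrSwap (1 : BipartiteOp m n) :=
  ⟨1, 1, isUnit_one, isUnit_one, Or.inl one_kronecker_one.symm⟩

theorem isLocalOrSwap_swapOperator (n : ℕ) : IsLocalOrSwap (swapOperator n n) :=
  ⟨1, 1, isUnit_one, isUnit_one, Or.inr ⟨rfl, by rw [one_kronecker_one, mul_one]⟩⟩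

theorem rank_le_of_vecMulVec_eq {α β γ : Type*} [Fintype β] {k : ℕ} {a x : α × β → ℂ}
    {b y : γ → ℂ} (h : vecMulVec a b = vecMulVec x y) (hb : b ≠ 0)
    (hx : (coordMatrix x).rank ≤ k) : (coordMatrix a).rank ≤ k := by
  obtain ⟨z, hz⟩ := Function.ne_iff.1 hb
  have hz : b z ≠ 0 := hz
  have : a = (y z / b z) • x := by
    ext p
    have := congrFun (congrFun h p) z
    simp only [vecMulVec_apply] at this
    simp only [Pi.smul_apply, smul_eq_mul]
    field_simp
    linear_combination this
  rw [this, map_smul]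
  exact (rank_smul_le _ _).trans hx

end BipartiteOperators

/-! ### Structure of the preservers for `k ≥ 2` and for `k = 1` -/

section Preservers

open Matrix

/-- With one side fixed, `exists_tensorVec_of_span` applies with `D` the vectors of Schmidt rank at
most one, since sums of two of them have rank at most `2 ≤ k`. Doing this on the left, then on the
right, removes both rank bounds. The partial transpose shows that the argument must fail for `k =
1`. -/
theorem vecMulVec_preserver {k m n : ℕ} (hk : 2 ≤ k) (hm : k < m) (hn : k < n)
    {Φ : Module.End ℂ (BipartiteOp m n)} (hΦ : Function.Injective Φ)
    (h : ∀ x y : Fin m × Fin n → ℂ, (coordMatrix x).rank ≤ k → (coordMatrix y).rank ≤ k →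
      ∃ c d, Φ (vecMulVec x y) = vecMulVec c d) (x y : Fin m × Fin n → ℂ) :
    ∃ c d, Φ (vecMulVec x y) = vecMulVec c d := by
  have : Nontrivial (Fin m) := Fin.nontrivial_iff_two_le.2 (by omega)
  have : Nontrivial (Fin n) := Fin.nontrivial_iff_two_le.2 (by omega)
  have hzero : ∃ c d, Φ 0 = vecMulVec c d := ⟨0, 0, by simp⟩
  let F : (((Fin m × Fin n) × (Fin m × Fin n)) → ℂ) →ₗ[ℂ] _ :=
    coordMatrix.symm.toLinearMap ∘ₗ Φ ∘ₗ coordMatrix.toLinearMap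
  have hF : Function.Injective F :=
    coordMatrix.symm.injective.comp (hΦ.comp coordMatrix.injective)
  have hFiff : ∀ x y, (∃ c d, F (tensorVec x y) = tensorVec c d) ↔
      ∃ c d, Φ (vecMulVec x y) = vecMulVec c d := fun x y =>
    exists_congr fun c => exists_congr fun d => by
      rw [← coordMatrix_tensorVec, ← coordMatrix_tensorVec]
      exact coordMatrix.symm_apply_eq
  have hadd : ∀ a ∈ {x : Fin m × Fin n → ℂ | (coordMatrix x).rank ≤ 1},
      ∀ b ∈ {x : Fin m × Fin n → ℂ | (coordMatrix x).rank ≤ 1},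
      (coordMatrix (a + b)).rank ≤ k := by
    intro a ha b hb
    rw [map_add]
    exact ((rank_add_le _ _).trans (add_le_add ha hb)).trans hk
  have hleft : ∀ x y : Fin m × Fin n → ℂ, (coordMatrix y).rank ≤ k →
      ∃ c d, Φ (vecMulVec x y) = vecMulVec c d := by
    intro x y hy
    by_cases hy0 : y = 0
    · simpa [hy0] using hzero
    rw [← hFiff]
    exact exists_tensorVec_of_span (f := F ∘ₗ (tensorVecBilin _ _).flip y)
      (hF.comp (tensorVec_left_injective hy0)) span_coordMatrix_rank_le_one
      (fun a ha => (hFiff a y).2 (h a y (le_trans ha (by omega)) hy))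
      (fun a ha b hb => (hFiff (a + b) y).2 (h _ y (hadd a ha b hb) hy)) x
  by_cases hx0 : x = 0
  · simpa [hx0] using hzero
  rw [← hFiff]
  exact exists_tensorVec_of_span (f := F ∘ₗ tensorVecBilin _ _ x)
    (hF.comp (tensorVec_right_injective hx0)) span_coordMatrix_rank_le_one
    (fun a ha => (hFiff x a).2 (hleft x a (le_trans ha (by omega))))
    (fun a ha b hb => (hFiff x (a + b)).2 (hleft x _ (hadd a ha b hb))) y

theorem isPreserverComp_of_two_le {k m n : ℕ} (hk : 2 ≤ k) (hm : k < m) (hn : k < n)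
    {Φ : Module.End ℂ (BipartiteOp m n)} (hΦ : Function.Injective Φ)
    (h : ∀ X ∈ rankOneSchmidt k m n, Φ X ∈ rankOneSchmidt k m n) : IsPreserverComp k Φ := by
  have : Nontrivial (Fin m) := Fin.nontrivial_iff_two_le.2 (by omega)
  have : Nontrivial (Fin n) := Fin.nontrivial_iff_two_le.2 (by omega)
  have h' : ∀ x y : Fin m × Fin n → ℂ, (coordMatrix x).rank ≤ k → (coordMatrix y).rank ≤ k →
      ∃ c d : Fin m × Fin n → ℂ, (coordMatrix c).rank ≤ k ∧ (coordMatrix d).rank ≤ k ∧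
        Φ (vecMulVec x y) = vecMulVec c d := fun x y hx hy =>
    (mem_rankOneSchmidt_iff (by omega) (by omega) (by omega)).1
      (h _ ((mem_rankOneSchmidt_iff (by omega) (by omega) (by omega)).2 ⟨x, y, hx, hy, rfl⟩))
  have hp := vecMulVec_preserver hk hm hn hΦ fun x y hx hy => by
    obtain ⟨c, d, -, -, hcd⟩ := h' x y hx hy
    exact ⟨c, d, hcd⟩
  let F : (((Fin m × Fin n) × (Fin m × Fin n)) → ℂ) →ₗ[ℂ] _ :=
    coordMatrix.symm.toLinearMap ∘ₗ Φ ∘ₗ coordMatrix.toLinearMap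
  have hΦb : Function.Bijective Φ := ⟨hΦ, LinearMap.injective_iff_surjective.1 hΦ⟩
  have hF : Function.Bijective F := coordMatrix.symm.bijective.comp (hΦb.comp coordMatrix.bijective)
  have hFiff : ∀ x y c d, F (tensorVec x y) = tensorVec c d ↔
      Φ (vecMulVec x y) = vecMulVec c d := fun x y c d => by
    rw [← coordMatrix_tensorVec, ← coordMatrix_tensorVec]
    exact coordMatrix.symm_apply_eq
  have h₁ : tensorVec (1 : Fin m → ℂ) (1 : Fin n → ℂ) ≠ 0 :=
    tensorVec_ne_zero one_ne_zero one_ne_zero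
  have hr₁ : (coordMatrix (tensorVec (1 : Fin m → ℂ) (1 : Fin n → ℂ))).rank ≤ k :=
    (rank_tensorVec_le _ _).trans (by omega)
  have hne : ∀ {A : (Fin m × Fin n → ℂ) →ₗ[ℂ] (Fin m × Fin n → ℂ)}, Function.Injective A →
      A (tensorVec 1 1) ≠ 0 := fun hA h0 => h₁ (hA (by simpa using h0))
  rcases tensorVec_preserver hF (fun x y => by
      obtain ⟨c, d, hcd⟩ := hp x y
      exact ⟨c, d, (hFiff _ _ _ _).2 hcd⟩) with ⟨A, B, hA, hB, hAB⟩ | ⟨A, B, hA, hB, hAB⟩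
  all_goals simp only [hFiff] at hAB
  -- Pairing `x` with the fixed product vector `1 ⊗ 1` keeps the operator in the set, so the Schmidt
  -- rank of `A x` can be read off from the image, up to a nonzero scalar.
  · obtain ⟨L, hL, hAL⟩ := exists_isLocalOrSwap (by omega) hm hn hA fun x hx => by
      obtain ⟨c, d, hc, -, hcd⟩ := h' x (tensorVec 1 1) hx hr₁
      exact rank_le_of_vecMulVec_eq ((hAB _ _).symm.trans hcd) (hne hB) hc
    obtain ⟨M, hM, hBM⟩ := exists_isLocalOrSwap (by omega) hm hn hB fun x hx => by
      obtain ⟨c, d, -, hd, hcd⟩ := h' (tensorVec 1 1) x hr₁ hx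
      refine rank_le_of_vecMulVec_eq (b := A (tensorVec 1 1)) (y := c) ?_ (hne hA) hd
      rw [← transpose_vecMulVec, ← transpose_vecMulVec c, ← hAB, hcd]
    rw [show Φ = mulLeftRight L Mᵀ from linearMap_eq_of_vecMulVec fun x y => by
      rw [hAB, mulLeftRight_apply, mul_vecMulVec, vecMulVec_mul, vecMul_transpose, hAL, hBM]]
    exact isPreserverComp_mulLeftRight hL hM.transpose
  · obtain ⟨L, hL, hAL⟩ := exists_isLocalOrSwap (by omega) hm hn hA fun x hx => by
      obtain ⟨c, d, -, hd, hcd⟩ := h' x (tensorVec 1 1) hx hr₁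
      refine rank_le_of_vecMulVec_eq (b := B (tensorVec 1 1)) (y := c) ?_ (hne hB) hd
      rw [← transpose_vecMulVec, ← transpose_vecMulVec c, ← hAB, hcd]
    obtain ⟨M, hM, hBM⟩ := exists_isLocalOrSwap (by omega) hm hn hB fun x hx => by
      obtain ⟨c, d, hc, -, hcd⟩ := h' (tensorVec 1 1) x hr₁ hx
      exact rank_le_of_vecMulVec_eq ((hAB _ _).symm.trans hcd) (hne hA) hc
    rw [show Φ = mulLeftRight M Lᵀ * transposeLinear m n from
      linearMap_eq_of_vecMulVec fun x y => by
        rw [hAB, Module.End.mul_apply, mulLeftRight_apply,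
          show transposeLinear m n (vecMulVec x y) = vecMulVec y x from transpose_vecMulVec x y,
          mul_vecMulVec, vecMulVec_mul, vecMul_transpose, hAL, hBM]]
    exact (isPreserverComp_mulLeftRight hM hL.transpose).mul (isPreserverComp_transpose k m n)

/-- The product operator `|a ⊗ b⟩⟨d ⊗ c|` (without conjugation). The factors are ordered so that
the swaps of adjacent factors are the swap operators and the partial transpose. -/
def productOp {α β γ δ : Type*} (a : α → ℂ) (b : β → ℂ) (c : γ → ℂ) (d : δ → ℂ) :
    Matrix (α × β) (δ × γ) ℂ :=
  vecMulVec (tensorVec a b) (tensorVec d c)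

theorem exists_perm_of_productOp {X : Fin 4 → Type} [∀ i, Finite (X i)] [∀ i, Nontrivial (X i)]
    {Φ : Module.End ℂ (Matrix (X 0 × X 1) (X 3 × X 2) ℂ)} (hΦ : Function.Bijective Φ)
    (hp : ∀ a b c d, ∃ a' b' c' d', Φ (productOp a b c d) = productOp a' b' c' d') :
    ∃ (σ : Equiv.Perm (Fin 4)) (A : ∀ i, (X i → ℂ) →ₗ[ℂ] (X (σ i) → ℂ)),
      (∀ i, Function.Injective (A i)) ∧ ∀ (v : ∀ i, X i → ℂ) (x : ∀ i, X i),
        Φ (productOp (v 0) (v 1) (v 2) (v 3)) (x 0, x 1) (x 3, x 2) =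
          ∏ i, A i (v i) (x (σ i)) := by
  let e : (∀ i, X i) ≃ (X 0 × X 1) × (X 3 × X 2) :=
    { toFun := fun x => ((x 0, x 1), (x 3, x 2))
      invFun := fun p => Fin.cons p.1.1 (Fin.cons p.1.2 (Fin.cons p.2.2
        (Fin.cons p.2.1 fun i => i.elim0)))
      left_inv := by
        intro x
        funext i
        fin_cases i <;> rfl
      right_inv := fun _ => rfl }
  let E : Matrix (X 0 × X 1) (X 3 × X 2) ℂ ≃ₗ[ℂ] ((∀ i, X i) → ℂ) :=
    coordMatrix.symm.trans (LinearEquiv.funCongrLeft ℂ ℂ e)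
  have hE : ∀ (v : ∀ i, X i → ℂ), pureTensor v = E (productOp (v 0) (v 1) (v 2) (v 3)) := by
    intro v
    ext x
    rw [pureTensor_apply, Fin.prod_univ_four]
    show _ = v 0 (x 0) * v 1 (x 1) * (v 3 (x 3) * v 2 (x 2))
    ring
  let Ψ : ((∀ i, X i) → ℂ) →ₗ[ℂ] ((∀ i, X i) → ℂ) := E.toLinearMap ∘ₗ Φ ∘ₗ E.symm.toLinearMap
  have hΨ : Function.Bijective Ψ := E.bijective.comp (hΦ.comp E.symm.bijective)
  have hΨE : ∀ t, Ψ (E t) = E (Φ t) := fun t => by simp [Ψ]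
  obtain ⟨σ, A, hA, h⟩ := exists_perm_of_isPure hΨ (by
    intro v
    obtain ⟨a, b, c, d, habcd⟩ := hp (v 0) (v 1) (v 2) (v 3)
    rw [hE, hΨE, habcd]
    exact ⟨_, (hE (Fin.cons a (Fin.cons b (Fin.cons c
      (Fin.cons d fun i => i.elim0))))).symm⟩)
  refine ⟨σ, A, hA, fun v x => ?_⟩
  rw [← h, hE, hΨE]
  rfl

theorem linearMap_eq_of_productOp {α β γ δ W : Type*} [Finite α] [Finite β] [Finite γ] [Finite δ]
    [AddCommGroup W] [Module ℂ W] {f g : Matrix (α × β) (δ × γ) ℂ →ₗ[ℂ] W}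
    (h : ∀ a b c d, f (productOp a b c d) = g (productOp a b c d)) : f = g := by
  refine linearMap_eq_of_vecMulVec fun x y => ?_
  let V (h : Matrix (α × β) (δ × γ) ℂ →ₗ[ℂ] W) :
      (α × β → ℂ) →ₗ[ℂ] (δ × γ → ℂ) →ₗ[ℂ] W :=
    (tensorVecBilin _ _).compr₂ (h ∘ₗ coordMatrix.toLinearMap)
  have hV : V f = V g := linearMap_eq_of_tensorVec fun a b =>
    linearMap_eq_of_tensorVec fun d c => h a b c d
  exact LinearMap.congr_fun (LinearMap.congr_fun hV x) y

/-- The local operators `X ↦ (A₀ ⊗ A₁) X (A₃ ⊗ A₂)ᵀ` followed by `Ψ`. -/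
theorem isPreserverComp_of_productOp {k m n : ℕ} {Φ Ψ : Module.End ℂ (BipartiteOp m n)}
    (hΨ : IsPreserverComp k Ψ) {A₀ A₃ : (Fin m → ℂ) →ₗ[ℂ] (Fin m → ℂ)}
    {A₁ A₂ : (Fin n → ℂ) →ₗ[ℂ] (Fin n → ℂ)} (h₀ : Function.Injective A₀)
    (h₁ : Function.Injective A₁) (h₂ : Function.Injective A₂) (h₃ : Function.Injective A₃)
    (h : ∀ a b c d, Φ (productOp a b c d) = Ψ (productOp (A₀ a) (A₁ b) (A₂ c) (A₃ d))) :
    IsPreserverComp k Φ := by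
  have hL : IsLocalOrSwap (A₀.toMatrix' ⊗ₖ A₁.toMatrix') := ⟨_, _,
    isUnit_toMatrix'_of_injective h₀, isUnit_toMatrix'_of_injective h₁, Or.inl rfl⟩
  have hM : IsLocalOrSwap (A₃.toMatrix' ⊗ₖ A₂.toMatrix') := ⟨_, _,
    isUnit_toMatrix'_of_injective h₃, isUnit_toMatrix'_of_injective h₂, Or.inl rfl⟩
  have : Φ = Ψ * mulLeftRight (A₀.toMatrix' ⊗ₖ A₁.toMatrix') (A₃.toMatrix' ⊗ₖ A₂.toMatrix')ᵀ := by
    refine linearMap_eq_of_productOp fun a b c d => ?_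
    rw [h, Module.End.mul_apply, mulLeftRight_apply]
    simp only [productOp, mul_vecMulVec, vecMulVec_mul, vecMul_transpose,
      kronecker_mulVec_tensorVec, LinearMap.toMatrix'_mulVec]
  rw [this]
  exact hΨ.mul (isPreserverComp_mulLeftRight hL hM.transpose)

/-- Every permutation of the four factors is realized by a composition of basic preservers. -/
theorem exists_isPreserverComp_perm {n : ℕ} (σ : Equiv.Perm (Fin 4)) :
    ∃ Ψ : Module.End ℂ (BipartiteOp n n), IsPreserverComp 1 Ψ ∧
      ∀ X (x : Fin 4 → Fin n), Ψ X (x 0, x 1) (x 3, x 2) =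
        X (x (σ 0), x (σ 1)) (x (σ 3), x (σ 2)) := by
  have hσ : σ ∈ Submonoid.closure
      (Set.range fun i : Fin 3 => Equiv.swap i.castSucc i.succ) := by
    rw [Equiv.Perm.mclosure_swap_castSucc_succ]
    exact Submonoid.mem_top σ
  induction hσ using Submonoid.closure_induction with
  | mem σ hσ =>
    obtain ⟨i, rfl⟩ := hσ
    have hone := isLocalOrSwap_one n n
    have hswap := isLocalOrSwap_swapOperator n
    -- The adjacent swaps act on the two row indices, on the second row and second column index, and
    -- on the two column indices.
    fin_cases i
    · refine ⟨_, isPreserverComp_mulLeftRight hswap hone, fun X x => ?_⟩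
      rw [mulLeftRight_apply, mul_one, swapOperator_mul]
      rfl
    · exact ⟨_, isPreserverComp_partialTranspose n n, fun X x => rfl⟩
    · refine ⟨_, isPreserverComp_mulLeftRight hone hswap, fun X x => ?_⟩
      rw [mulLeftRight_apply, one_mul, mul_swapOperator]
      rfl
  | one =>
    refine ⟨_, isPreserverComp_mulLeftRight (isLocalOrSwap_one n n) (isLocalOrSwap_one n n),
      fun X x => ?_⟩
    rw [mulLeftRight_apply, mul_one, one_mul]
    rfl
  | mul σ τ _ _ hσ hτ =>
    obtain ⟨Ψ, hΨ, h⟩ := hσ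
    obtain ⟨Ψ', hΨ', h'⟩ := hτ
    refine ⟨Ψ * Ψ', hΨ.mul hΨ', fun X x => ?_⟩
    rw [Module.End.mul_apply, h]
    exact h' X (x ∘ σ)

theorem exists_productOp_of_mem {m n : ℕ} (hm : 0 < m) (hn : 0 < n)
    {Φ : Module.End ℂ (BipartiteOp m n)}
    (h : ∀ X ∈ rankOneSchmidt 1 m n, Φ X ∈ rankOneSchmidt 1 m n) (a b c d) :
    ∃ a' b' c' d', Φ (productOp a b c d) = productOp a' b' c' d' := by
  obtain ⟨x, y, hx, hy, hxy⟩ := (mem_rankOneSchmidt_iff le_rfl hm hn).1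
    (h _ ((mem_rankOneSchmidt_iff le_rfl hm hn).2
      ⟨tensorVec a b, tensorVec d c, rank_tensorVec_le _ _, rank_tensorVec_le _ _, rfl⟩))
  obtain ⟨a', b', rfl⟩ := exists_eq_tensorVec hx
  obtain ⟨d', c', rfl⟩ := exists_eq_tensorVec hy
  exact ⟨a', b', c', d', hxy⟩

theorem isPreserverComp_of_eq {n : ℕ} (hn : 1 < n)
    {Φ : Module.End ℂ (BipartiteOp n n)} (hΦ : Function.Injective Φ)
    (h : ∀ X ∈ rankOneSchmidt 1 n n, Φ X ∈ rankOneSchmidt 1 n n) : IsPreserverComp 1 Φ := by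
  have : Nontrivial (Fin n) := Fin.nontrivial_iff_two_le.2 hn
  obtain ⟨σ, A, hA, hΦA⟩ := exists_perm_of_productOp (X := fun _ => Fin n) (Φ := Φ)
    ⟨hΦ, LinearMap.injective_iff_surjective.1 hΦ⟩
    (exists_productOp_of_mem (Nat.zero_lt_of_lt hn) (Nat.zero_lt_of_lt hn) h)
  obtain ⟨Ψ, hΨ, hΨσ⟩ := exists_isPreserverComp_perm (n := n) σ
  refine isPreserverComp_of_productOp hΨ (hA 0) (hA 1) (hA 2) (hA 3) fun a b c d => ?_
  ext p q
  refine (hΦA ![a, b, c, d] ![p.1, p.2, q.2, q.1]).trans ?_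
  refine Eq.trans ?_ (hΨσ _ ![p.1, p.2, q.2, q.1]).symm
  rw [Fin.prod_univ_four]
  simp only [productOp, vecMulVec_apply, tensorVec]
  simp only [Matrix.cons_val]
  ring

/-- Injectivity of `A i` forbids sending a factor to one of smaller dimension. So `σ` preserves the
pair of larger dimension, hence also the other pair, and only four permutations remain. -/
theorem isPreserverComp_of_ne {m n : ℕ} (hmn : m ≠ n) (hm : 1 < m) (hn : 1 < n)
    {Φ : Module.End ℂ (BipartiteOp m n)} (hΦ : Function.Injective Φ)
    (h : ∀ X ∈ rankOneSchmidt 1 m n, Φ X ∈ rankOneSchmidt 1 m n) : IsPreserverComp 1 Φ := by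
  have hΦb : Function.Bijective Φ := ⟨hΦ, LinearMap.injective_iff_surjective.1 hΦ⟩
  let d : Fin 4 → ℕ := ![m, n, n, m]
  have hd : ∀ i, 2 ≤ d i := by
    intro i
    fin_cases i <;> assumption
  have : ∀ i, Nontrivial (Fin (d i)) := fun i => Fin.nontrivial_iff_two_le.2 (hd i)
  obtain ⟨σ, A, hA, hΦA⟩ := exists_perm_of_productOp (X := fun i => Fin (d i)) (Φ := Φ)
    hΦb
    (exists_productOp_of_mem (Nat.zero_lt_of_lt hm) (Nat.zero_lt_of_lt hn) h)
  have hle : ∀ i, d i ≤ d (σ i) := fun i => by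
    simpa using LinearMap.finrank_le_finrank_of_injective (hA i)
  have hΦA' : ∀ (a : Fin m → ℂ) (b c : Fin n → ℂ) (d' : Fin m → ℂ) (x : ∀ i, Fin (d i)),
      Φ (productOp a b c d') (x 0, x 1) (x 3, x 2) =
        A 0 a (x (σ 0)) * A 1 b (x (σ 1)) * A 2 c (x (σ 2)) * A 3 d' (x (σ 3)) := by
    intro a b c d' x
    have := hΦA (Fin.cons a (Fin.cons b (Fin.cons c (Fin.cons d' fun i => i.elim0)))) x
    rw [Fin.prod_univ_four] at this
    exact this
  let point (p q : Fin m × Fin n) : ∀ i, Fin (d i) :=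
    Fin.cons p.1 (Fin.cons p.2 (Fin.cons q.2 (Fin.cons q.1 fun i => i.elim0)))
  have hσ : σ = 1 ∨ σ = Equiv.swap 1 2 ∨ σ = Equiv.swap 0 3 ∨
      σ = Equiv.swap 0 3 * Equiv.swap 1 2 := by
    -- The first alternative is the case `m < n`, the second `n < m`; either one confines `σ` to the
    -- same four permutations.
    have key : (σ 1 = 1 ∨ σ 1 = 2) ∧ (σ 2 = 1 ∨ σ 2 = 2) ∨
        (σ 0 = 0 ∨ σ 0 = 3) ∧ (σ 3 = 0 ∨ σ 3 = 3) := by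
      have h4 : ∀ j, (j = 0 ∨ j = 3) ∧ d j = m ∨ (j = 1 ∨ j = 2) ∧ d j = n := by
        intro j
        fin_cases j <;> simp [d]
      have hle0 : m ≤ d (σ 0) := hle 0
      have hle1 : n ≤ d (σ 1) := hle 1
      have hle2 : n ≤ d (σ 2) := hle 2
      have hle3 : m ≤ d (σ 3) := hle 3
      rcases lt_or_gt_of_ne hmn with hlt | hlt
      · left
        constructor
        · rcases h4 (σ 1) with h | h
          · omega
          · exact h.1
        · rcases h4 (σ 2) with h | h
          · omega
          · exact h.1
      · right
        constructor
        · rcases h4 (σ 0) with h | h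
          · exact h.1
          · omega
        · rcases h4 (σ 3) with h | h
          · exact h.1
          · omega
    exact (by decide : ∀ σ : Equiv.Perm (Fin 4), ((σ 1 = 1 ∨ σ 1 = 2) ∧ (σ 2 = 1 ∨ σ 2 = 2) ∨
      (σ 0 = 0 ∨ σ 0 = 3) ∧ (σ 3 = 0 ∨ σ 3 = 3)) → σ = 1 ∨ σ = Equiv.swap 1 2 ∨
      σ = Equiv.swap 0 3 ∨ σ = Equiv.swap 0 3 * Equiv.swap 1 2) σ key
  have hone := isPreserverComp_mulLeftRight (k := 1) (isLocalOrSwap_one m n) (isLocalOrSwap_one m n)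
  have hpt := isPreserverComp_partialTranspose m n
  have ht := isPreserverComp_transpose 1 m n
  rcases hσ with rfl | rfl | rfl | rfl
  · refine isPreserverComp_of_productOp hone (hA 0) (hA 1) (hA 2) (hA 3) fun a b c d' => ?_
    ext p q
    refine (hΦA' a b c d' (point p q)).trans ?_
    rw [mulLeftRight_apply, one_mul, mul_one]
    show A 0 a p.1 * A 1 b p.2 * A 2 c q.2 * A 3 d' q.1 =
      A 0 a p.1 * A 1 b p.2 * (A 3 d' q.1 * A 2 c q.2)
    ring
  · refine isPreserverComp_of_productOp hpt (hA 0) (hA 1) (hA 2) (hA 3) fun a b c d' => ?_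
    ext p q
    refine (hΦA' a b c d' (point p q)).trans ?_
    show A 0 a p.1 * A 1 b q.2 * A 2 c p.2 * A 3 d' q.1 =
      A 0 a p.1 * A 1 b q.2 * (A 3 d' q.1 * A 2 c p.2)
    ring
  · refine isPreserverComp_of_productOp (ht.mul hpt) (hA 0) (hA 1) (hA 2) (hA 3) fun a b c d' => ?_
    ext p q
    refine (hΦA' a b c d' (point p q)).trans ?_
    show A 0 a q.1 * A 1 b p.2 * A 2 c q.2 * A 3 d' p.1 =
      A 0 a q.1 * A 1 b p.2 * (A 3 d' p.1 * A 2 c q.2)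
    ring
  · refine isPreserverComp_of_productOp ht (hA 0) (hA 1) (hA 2) (hA 3) fun a b c d' => ?_
    ext p q
    refine (hΦA' a b c d' (point p q)).trans ?_
    show A 0 a q.1 * A 1 b q.2 * A 2 c p.2 * A 3 d' p.1 =
      A 0 a q.1 * A 1 b q.2 * (A 3 d' p.1 * A 2 c p.2)
    ring

end Preservers

/-- Products in `Module.End` are compositions. -/
theorem theorem4p3 (k m n : ℕ) (hk : 1 ≤ k) (hkmn : k < min m n)
    (Φ : BipartiteOp m n ≃ₗ[ℂ] BipartiteOp m n) :
    Φ '' rankOneSchmidt k m n ⊆ rankOneSchmidt k m n ↔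
      ∃ l : List (Module.End ℂ (BipartiteOp m n)),
        l ≠ [] ∧ (∀ Ψ ∈ l, IsBasicPreserver k Ψ) ∧ Φ.toLinearMap = l.prod := by
  obtain ⟨hm, hn⟩ := lt_min_iff.1 hkmn
  constructor
  · intro h
    have h' : ∀ X ∈ rankOneSchmidt k m n, Φ.toLinearMap X ∈ rankOneSchmidt k m n :=
      fun X hX => h ⟨X, hX, rfl⟩
    rcases hk.eq_or_lt with rfl | hk
    · rcases eq_or_ne m n with rfl | hmn
      · exact isPreserverComp_of_eq hm Φ.injective h'
      · exact isPreserverComp_of_ne hmn hm hn Φ.injective h'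
    · exact isPreserverComp_of_two_le hk hm hn Φ.injective h'
  · rintro h _ ⟨X, hX, rfl⟩
    exact IsPreserverComp.map_mem hk (by omega) (by omega) h hX
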